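/- **Conventions.** Let $X$ be a finite graph on $N$ vertices (undirected, no loops or multiple edges) with adjacency matrix $d$. A matrix $u=(u_{ij})$ over a unital $*$-algebra is *magic* if its entries are projections ($p^2=p=p^*$) which sum to $1$ on each row and on each column. The quantum automorphism group $G^+(X)$ is given by the universal unital C$^*$-algebra $C(G^+(X))$ generated by the entries of a magic $N\times N$ matrix $u$ with $du=ud$. For a finite quantum group $G$, with finite-dimensional C$^*$-algebra $C(G)$ and comultiplication $\Delta$, an embedding $G\subset S_N^+$ is a magic matrix $u\in M_N(C(G))$ whose entries generate $C(G)$ and such that $\Delta(u_{ij})=\sum_k u_{ik}\otimes u_{kj}$; it acts on $X$ if $du=ud$. One writes $G=G^+(X)$ if there is an embedding $v$ of $G$ such that the $*$-algebras generated by the entries of $v$ and of the fundamental magic matrix $u$ of $C(G^+(X))$ are isomorphic via $u_{ij}\mapsto v_{ij}$; $G$ has the *Frucht property* if $G=G^+(X)$ for some finite graph $X$. The *orbitals* of $G\subset S_N^+$ are the classes of the relation $(i,k)\sim(j,l)\iff u_{ij}u_{kl}\neq0$. The *classical version* of $G$ is the group of characters of $C(G)$ with product $(\varphi\otimes\psi)\Delta$.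 The Kac–Paljutkin quantum group $G_0$ of order $8$ has $C(G_0)=\mathbb C f_1\oplus\mathbb C f_2\oplus\mathbb C f_3\oplus\mathbb C f_4\oplus M_2(\mathbb C)$, with matrix units $E_{kl}$ in $M_2(\mathbb C)$, and comultiplication $$\begin{aligned} \Delta(f_1)&=\textstyle\sum_i f_i\otimes f_i+\tfrac12\sum_{k,l}E_{kl}\otimes E_{kl},\\ \Delta(f_2)&=f_1\otimes f_2+f_2\otimes f_1+f_3\otimes f_4+f_4\otimes f_3+\tfrac12(E_{11}\otimes E_{22}+E_{22}\otimes E_{11})+\tfrac i2(E_{21}\otimes E_{12}-E_{12}\otimes E_{21}),\\ \Delta(f_3)&=f_1\otimes f_3+f_3\otimes f_1+f_2\otimes f_4+f_4\otimes f_2+\tfrac12(E_{11}\otimes E_{22}+E_{22}\otimes E_{11})-\tfrac i2(E_{21}\otimes E_{12}-E_{12}\otimes E_{21}),\\ \Delta(f_4)&=f_1\otimes f_4+f_4\otimes f_1+f_2\otimes f_3+f_3\otimes f_2+\tfrac12(E_{11}\otimes E_{11}+E_{22}\otimes E_{22}-E_{12}\otimes E_{12}-E_{21}\otimes E_{21}),\\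 \Delta(E_{11})&=(f_1+f_4)\otimes E_{11}+E_{11}\otimes(f_1+f_4)+(f_2+f_3)\otimes E_{22}+E_{22}\otimes(f_2+f_3),\\ \Delta(E_{22})&=(f_1+f_4)\otimes E_{22}+E_{22}\otimes(f_1+f_4)+(f_2+f_3)\otimes E_{11}+E_{11}\otimes(f_2+f_3),\\ \Delta(E_{12})&=(f_1-f_4)\otimes E_{12}+E_{12}\otimes(f_1-f_4)+i\big((f_2-f_3)\otimes E_{21}-E_{21}\otimes(f_2-f_3)\big),\\ \Delta(E_{21})&=(f_1-f_4)\otimes E_{21}+E_{21}\otimes(f_1-f_4)-i\big((f_2-f_3)\otimes E_{12}-E_{12}\otimes(f_2-f_3)\big). \end{aligned}$$ With $I_2$ the unit of $M_2(\mathbb C)$, $p=\frac12\begin{pmatrix}1&e^{-i\pi/4}\\e^{i\pi/4}&1\end{pmatrix}$, $a=f_1+f_4$, $b=f_2+f_3$, consider the magic matrices $$u^{G_0}=\begin{pmatrix}f_1+f_2&f_3+f_4&p&I_2-p\\f_3+f_4&f_1+f_2&I_2-p&p\\p^T&I_2-p^T&f_1+f_3&f_2+f_4\\I_2-p^T&p^T&f_2+f_4&f_1+f_3\end{pmatrix},\quad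 w=\begin{pmatrix}a&b&E_{11}&E_{22}\\b&a&E_{22}&E_{11}\\E_{11}&E_{22}&a&b\\E_{22}&E_{11}&b&a\end{pmatrix},$$ and $x,y,z$, of the form $\begin{pmatrix}q&1-q\\1-q&q\end{pmatrix}$ with $q=f_1+f_2+f_3+f_4$, $q=a+E_{11}$, $q=a+E_{22}$ respectively. Let $$D_4=\{e,(12),(34),(12)(34),(13)(24),(14)(23),(1324),(1423)\}\subset S_4,$$ and for $\omega\in D_4$ let $b_1(\omega)=1$ if $\omega$ exchanges $\{1,2\}$ and $\{3,4\}$, and $b_1(\omega)=0$ otherwise. **Theorem.** The Kac–Paljutkin quantum group $G_0$ does not have the Frucht property: there is no finite graph $X$ with $G^+(X)=G_0$. More precisely: 1. For every embedding $G_0\subset S_N^+$ the vertices can be relabelled so that $u$ is block diagonal with blocks from $u^{G_0},w,x,y,z,1$, where $u^{G_0}$ occurs. Let $\omega\in D_4$ (a group isomorphic to the dihedral group of order $8$) act on each block of type $u^{G_0}$ as $\omega$, on blocks of type $w$ as $[(13)(24)]^{b_1(\omega)}$, on blocks of type $x$ and $z$ as $(12)^{b_1(\omega)}$, and trivially on blocks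 of type $y$ and $1$. This is an injective group homomorphism from $D_4$ to the permutations of the vertices, each of its values maps every orbital onto itself, and if $G_0$ acts on a graph $X$ via this embedding, then each of its values is an automorphism of $X$; thus $D_4\subset G(X)$. 2. The classical version of $G_0$ is isomorphic to $\mathbb Z_2\times\mathbb Z_2$. -/

import Mathlib

open scoped TensorProduct

/-! ## Magic unitaries, and the quantum automorphism group of a finite graph -/

namespace QuantumAut

open scoped ENNReal CStarAlgebra

section Graph

variable {V : Type*} [Fintype V]

/-- A magic unitary: a square matrix of projections (`p * p = p` and `star p = p`), which sum to
`1` on each row and on each column. -/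
structure IsMagic {A : Type*} [Ring A] [StarRing A] (u : Matrix V V A) : Prop where
  proj : ∀ i j, IsStarProjection (u i j)
  row : ∀ i, ∑ j, u i j = 1
  col : ∀ j, ∑ i, u i j = 1

open Classical in
/-- `d u = u d`, where `d` is the adjacency matrix of the graph `X`. -/
def Preserves {A : Type*} [Ring A] (u : Matrix V V A) (X : SimpleGraph V) : Prop :=
  X.adjMatrix A * u = u * X.adjMatrix A

/-- The set of matrix entries. -/
def entries {A : Type*} (u : Matrix V V A) : Set A := Set.range fun ij : V × V => u ij.1 ij.2

/-- A representation, in some unital C⋆-algebra, of the relations "`v` is magic and `d v = v d`". -/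
structure GraphModel (X : SimpleGraph V) where
  B : Type
  [cstar : CStarAlgebra B]
  [nontriv : Nontrivial B]
  v : Matrix V V B
  magic : IsMagic v
  preserves : Preserves v X

attribute [instance] GraphModel.cstar GraphModel.nontriv

noncomputable section

/-- The C⋆-algebra of all bounded families indexed by the representations of the relations. -/
abbrev BigProduct (X : SimpleGraph V) : Type _ := lp (fun m : GraphModel X => m.B) ∞

instance (X : SimpleGraph V) : CStarAlgebra (BigProduct X) where

/-- The `(i, j)` entries of all representations of the relations at once. -/
def coordinate (X : SimpleGraph V) (i j : V) : BigProduct X :=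
  ⟨fun m => m.v i j, memℓp_infty ⟨1, by rintro _ ⟨m, rfl⟩; exact (m.magic.proj i j).norm_le⟩⟩

/-- `C(G⁺(X))`, the universal C⋆-algebra generated by the entries of a magic unitary `u` with
`d u = u d`, in other words the quotient of `C(S_N⁺)` by the relations `d u = u d`. It is realised as the C⋆-algebra generated by the universal representation of these
relations. Its universal property is `existsUnique_hom` below. -/
def QAutAlg (X : SimpleGraph V) : StarSubalgebra ℂ (BigProduct X) :=
  (StarAlgebra.adjoin ℂ (Set.range fun ij : V × V => coordinate X ij.1 ij.2)).topologicalClosure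

instance (X : SimpleGraph V) : CStarAlgebra (QAutAlg X) :=
  haveI : IsClosed (QAutAlg X : Set (BigProduct X)) := StarSubalgebra.isClosed_topologicalClosure _
  inferInstance

/-- The fundamental magic unitary `u` of `C(G⁺(X))`. -/
def fund (X : SimpleGraph V) : Matrix V V (QAutAlg X) := Matrix.of fun i j =>
  ⟨coordinate X i j, StarSubalgebra.le_topologicalClosure _
    (StarAlgebra.subset_adjoin ℂ _ ⟨(i, j), rfl⟩)⟩

/-- Evaluation of a bounded family at one representation of the relations. -/
def evalHom (X : SimpleGraph V) (m : GraphModel X) : BigProduct X →⋆ₐ[ℂ] m.B where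
  toFun a := a m
  map_one' := rfl
  map_mul' _ _ := rfl
  map_zero' := rfl
  map_add' _ _ := rfl
  commutes' _ := rfl
  map_star' _ := rfl

theorem fund_isMagic (X : SimpleGraph V) : IsMagic (fund X) where
  proj i j := ⟨Subtype.ext (lp.ext (funext fun m => (m.magic.proj i j).isIdempotentElem)),
    Subtype.ext (lp.ext (funext fun m => (m.magic.proj i j).isSelfAdjoint))⟩
  row i := Subtype.ext (lp.ext (funext fun m => by
    change (evalHom X m) (((QAutAlg X).subtype) (∑ j, fund X i j)) = 1
    rw [map_sum, map_sum]
    exact m.magic.row i))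
  col j := Subtype.ext (lp.ext (funext fun m => by
    change (evalHom X m) (((QAutAlg X).subtype) (∑ i, fund X i j)) = 1
    rw [map_sum, map_sum]
    exact m.magic.col j))

theorem fund_preserves (X : SimpleGraph V) : Preserves (fund X) X := by
  classical
  refine Matrix.ext fun i j => Subtype.ext (lp.ext (funext fun m => ?_))
  have h := congrFun (congrFun m.preserves i) j
  change (evalHom X m) (((QAutAlg X).subtype) ((X.adjMatrix (QAutAlg X) * fund X) i j))
    = (evalHom X m) (((QAutAlg X).subtype) ((fund X * X.adjMatrix (QAutAlg X)) i j))
  simp only [Matrix.mul_apply, map_sum, map_mul, SimpleGraph.adjMatrix_apply,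
    apply_ite (evalHom X m), apply_ite (QAutAlg X).subtype, map_one, map_zero] at h ⊢
  exact h

/-- The universal property of `C(G⁺(X))`. -/
theorem existsUnique_hom (X : SimpleGraph V) (B : Type) [CStarAlgebra B] [Nontrivial B]
    (v : Matrix V V B) (hv : IsMagic v) (hX : Preserves v X) :
    ∃! φ : QAutAlg X →⋆ₐ[ℂ] B, ∀ i j, φ (fund X i j) = v i j := by
  have key : ∀ φ ψ : QAutAlg X →⋆ₐ[ℂ] B, (∀ i j, φ (fund X i j) = ψ (fund X i j)) → φ = ψ := by
    intro φ ψ h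
    have hφ : Continuous φ := map_continuous φ
    have hψ : Continuous ψ := map_continuous ψ
    refine StarAlgHom.ext_topologicalClosure hφ hψ (StarAlgHom.ext_adjoin ?_)
    rintro ⟨_, hx⟩ ⟨⟨i, j⟩, rfl⟩
    exact h i j
  exact ⟨(evalHom X ⟨B, v, hv, hX⟩).comp (QAutAlg X).subtype, fun _ _ => rfl,
    fun φ hφ => key _ _ hφ⟩

end

end Graph

section Rep

variable {V : Type*} [Fintype V]
variable {A : Type*} [Ring A] [StarRing A] [Algebra ℂ A] [StarModule ℂ A] [Coalgebra ℂ A]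

/-- An embedding `G ⊂ S_N⁺` of the finite quantum group `G` with (finite-dimensional) algebra of
functions `A = C(G)`: a magic unitary with `Δ(u_{ij}) = ∑ₖ u_{ik} ⊗ u_{kj}` whose entries
generate `A`. That `ε(u_{ij}) = δ_{ij}` and `S(u_{ij}) = star u_{ji}` follows. -/
structure IsFundamentalMagicRep (u : Matrix V V A) : Prop where
  magic : IsMagic u
  comul : ∀ i j, Coalgebra.comul (R := ℂ) (u i j) = ∑ k, u i k ⊗ₜ[ℂ] u k j
  generates : StarAlgebra.adjoin ℂ (entries u) = ⊤

/-- The identification `(A, u) = (B, v)` of Woronowicz algebras: the ⋆-algebras generated by the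
entries are isomorphic, via `u_{ij} ↦ v_{ij}`. -/
def SameWoronowicz {B C : Type*} [Ring B] [StarRing B] [Algebra ℂ B] [StarModule ℂ B]
    [Ring C] [StarRing C] [Algebra ℂ C] [StarModule ℂ C]
    (u : Matrix V V B) (v : Matrix V V C) : Prop :=
  ∃ φ : StarAlgebra.adjoin ℂ (entries u) ≃⋆ₐ[ℂ] StarAlgebra.adjoin ℂ (entries v),
    ∀ i j, (φ ⟨u i j, StarAlgebra.subset_adjoin ℂ _ ⟨(i, j), rfl⟩⟩ : C) = v i j

variable (A) in
/-- The Frucht property of the finite quantum group `G` with `C(G) = A`: there is a finite graph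
`X` with `G = G⁺(X)`. That is, `G` has a fundamental representation `v`, necessarily magic, such
that `(C(G), v)` and `C(G⁺(X))`, with its fundamental magic unitary, are the same. -/
def HasFruchtProperty : Prop :=
  ∃ (N : ℕ) (X : SimpleGraph (Fin N)) (v : Matrix (Fin N) (Fin N) A),
    IsFundamentalMagicRep v ∧ SameWoronowicz (fund X) v

/-- The relation `(i, k) ∼ (j, l) ↔ u_{ij} u_{kl} ≠ 0`. -/
def OrbitalRel (u : Matrix V V A) (a b : V × V) : Prop := u a.1 b.1 * u a.2 b.2 ≠ 0

/-- Orbitals are the classes of the relation `OrbitalRel u`. -/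
def IsOrbital (u : Matrix V V A) (o : Set (V × V)) : Prop :=
  ∃ a : V × V, o = {b | OrbitalRel u a b}

end Rep

/-- The classical version of a finite quantum group with `C(G) = A`: the Gelfand spectrum of the
abelianisation of `A`, that is, the set of all characters of `A` (these vanish on the commutator
ideal, and preserve `star`), with multiplication `φ ψ = (φ ⊗ ψ) Δ`. -/
abbrev ClassicalVersion (A : Type*) [Ring A] [Bialgebra ℂ A] : Type _ := WithConv (A →ₐ[ℂ] ℂ)

end QuantumAut

/-! ## The Kac–Paljutkin quantum group -/

namespace KacPaljutkin

/-- The algebra of functions `C(G₀) = ℂ ⊕ ℂ ⊕ ℂ ⊕ ℂ ⊕ M₂(ℂ)`. -/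
def KP : Type := (Fin 4 → ℂ) × Matrix (Fin 2) (Fin 2) ℂ

noncomputable section

instance : Ring KP :=
  inferInstanceAs (Ring ((Fin 4 → ℂ) × Matrix (Fin 2) (Fin 2) ℂ))
instance : StarRing KP :=
  inferInstanceAs (StarRing ((Fin 4 → ℂ) × Matrix (Fin 2) (Fin 2) ℂ))
instance : Algebra ℂ KP :=
  inferInstanceAs (Algebra ℂ ((Fin 4 → ℂ) × Matrix (Fin 2) (Fin 2) ℂ))
instance : StarModule ℂ KP :=
  inferInstanceAs (StarModule ℂ ((Fin 4 → ℂ) × Matrix (Fin 2) (Fin 2) ℂ))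

open scoped Matrix.Norms.L2Operator in
/-- `C(G₀)` is a C⋆-algebra. The norm plays no role in what follows. -/
abbrev cstarAlgebra : CStarAlgebra KP :=
  inferInstanceAs (CStarAlgebra ((Fin 4 → ℂ) × Matrix (Fin 2) (Fin 2) ℂ))

namespace KP

@[ext] theorem ext {a b : KP} (h₁ : ∀ i, a.1 i = b.1 i) (h₂ : ∀ k l, a.2 k l = b.2 k l) : a = b :=
  Prod.ext (funext h₁) (Matrix.ext h₂)
@[simp] theorem fst_add (a b : KP) : (a + b).1 = a.1 + b.1 := rfl
@[simp] theorem snd_add (a b : KP) : (a + b).2 = a.2 + b.2 := rfl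
@[simp] theorem fst_mul (a b : KP) : (a * b).1 = a.1 * b.1 := rfl
@[simp] theorem snd_mul (a b : KP) : (a * b).2 = a.2 * b.2 := rfl
@[simp] theorem fst_smul (c : ℂ) (a : KP) : (c • a).1 = c • a.1 := rfl
@[simp] theorem snd_smul (c : ℂ) (a : KP) : (c • a).2 = c • a.2 := rfl
@[simp] theorem fst_one : (1 : KP).1 = 1 := rfl
@[simp] theorem snd_one : (1 : KP).2 = 1 := rfl
@[simp] theorem fst_zero : (0 : KP).1 = 0 := rfl
@[simp] theorem snd_zero : (0 : KP).2 = 0 := rfl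
@[simp] theorem fst_star (a : KP) : (star a).1 = star a.1 := rfl
@[simp] theorem snd_star (a : KP) : (star a).2 = star a.2 := rfl

end KP

/-- The unit of the `i`-th copy of `ℂ`; with indices starting at `0`. -/
def f (i : Fin 4) : KP := (Pi.single i 1, 0)

/-- The matrix units of the summand `M₂(ℂ)`. -/
def E (k l : Fin 2) : KP := (0, Matrix.single k l 1)


/-- The element of `C(G₀)` given by a matrix in the summand `M₂(ℂ)`. -/
def ofMat (m : Matrix (Fin 2) (Fin 2) ℂ) : KP := (0, m)

@[simp] theorem f_fst (i : Fin 4) : (f i).1 = Pi.single i 1 := rfl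
@[simp] theorem f_snd (i : Fin 4) : (f i).2 = 0 := rfl
@[simp] theorem E_fst (k l : Fin 2) : (E k l).1 = 0 := rfl
@[simp] theorem E_snd (k l : Fin 2) : (E k l).2 = Matrix.single k l 1 := rfl

theorem eq_sum (a : KP) : a = ∑ i, a.1 i • f i + ∑ k, ∑ l, a.2 k l • E k l := by
  ext i j
  · fin_cases i <;> simp [Fin.sum_univ_four]
  · fin_cases i <;> fin_cases j <;> simp [Fin.sum_univ_four]

theorem linearMap_ext {M : Type*} [AddCommMonoid M] [Module ℂ M] {φ ψ : KP →ₗ[ℂ] M}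
    (hf : ∀ i, φ (f i) = ψ (f i)) (hE : ∀ k l, φ (E k l) = ψ (E k l)) : φ = ψ := by
  refine LinearMap.ext fun a => ?_
  rw [eq_sum a]
  simp only [map_add, map_sum, map_smul, hf, hE]

theorem one_eq : (1 : KP) = f 0 + f 1 + f 2 + f 3 + E 0 0 + E 1 1 := by
  ext i j
  · fin_cases i <;> simp
  · fin_cases i <;> fin_cases j <;> simp

theorem f_mul_f (i j : Fin 4) : f i * f j = if i = j then f i else 0 := by
  ext k l
  · split_ifs <;> simp [Pi.single_apply] <;> grind
  · split_ifs <;> simp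
theorem f_mul_E (i : Fin 4) (k l : Fin 2) : f i * E k l = 0 := by ext <;> simp
theorem E_mul_f (i : Fin 4) (k l : Fin 2) : E k l * f i = 0 := by ext <;> simp
theorem E_mul_E (k l m n : Fin 2) : E k l * E m n = if l = m then E k n else 0 := by
  split_ifs with h
  · subst h; ext <;> simp
  · ext <;> simp [h]

open Complex (I)

/-- The elements `Δ(fᵢ)`. -/
def comulF : Fin 4 → KP ⊗[ℂ] KP :=
  ![f 0 ⊗ₜ f 0 + f 1 ⊗ₜ f 1 + f 2 ⊗ₜ f 2 + f 3 ⊗ₜ f 3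
      + (1 / 2 : ℂ) • (E 0 0 ⊗ₜ E 0 0 + E 0 1 ⊗ₜ E 0 1 + E 1 0 ⊗ₜ E 1 0 + E 1 1 ⊗ₜ E 1 1),
    f 0 ⊗ₜ f 1 + f 1 ⊗ₜ f 0 + f 2 ⊗ₜ f 3 + f 3 ⊗ₜ f 2
      + (1 / 2 : ℂ) • (E 0 0 ⊗ₜ E 1 1 + E 1 1 ⊗ₜ E 0 0)
      + (I / 2) • (E 1 0 ⊗ₜ E 0 1 - E 0 1 ⊗ₜ E 1 0),
    f 0 ⊗ₜ f 2 + f 2 ⊗ₜ f 0 + f 1 ⊗ₜ f 3 + f 3 ⊗ₜ f 1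
      + (1 / 2 : ℂ) • (E 0 0 ⊗ₜ E 1 1 + E 1 1 ⊗ₜ E 0 0)
      - (I / 2) • (E 1 0 ⊗ₜ E 0 1 - E 0 1 ⊗ₜ E 1 0),
    f 0 ⊗ₜ f 3 + f 3 ⊗ₜ f 0 + f 1 ⊗ₜ f 2 + f 2 ⊗ₜ f 1
      + (1 / 2 : ℂ) • (E 0 0 ⊗ₜ E 0 0 + E 1 1 ⊗ₜ E 1 1 - E 0 1 ⊗ₜ E 0 1 - E 1 0 ⊗ₜ E 1 0)]

/-- The elements `Δ(E_{kl})`. -/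
def comulE : Matrix (Fin 2) (Fin 2) (KP ⊗[ℂ] KP) :=
  !![(f 0 + f 3) ⊗ₜ E 0 0 + E 0 0 ⊗ₜ (f 0 + f 3) + (f 1 + f 2) ⊗ₜ E 1 1 + E 1 1 ⊗ₜ (f 1 + f 2),
    (f 0 - f 3) ⊗ₜ E 0 1 + E 0 1 ⊗ₜ (f 0 - f 3)
      + I • ((f 1 - f 2) ⊗ₜ E 1 0 - E 1 0 ⊗ₜ (f 1 - f 2));
    (f 0 - f 3) ⊗ₜ E 1 0 + E 1 0 ⊗ₜ (f 0 - f 3)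
      - I • ((f 1 - f 2) ⊗ₜ E 0 1 - E 0 1 ⊗ₜ (f 1 - f 2)),
    (f 0 + f 3) ⊗ₜ E 1 1 + E 1 1 ⊗ₜ (f 0 + f 3) + (f 1 + f 2) ⊗ₜ E 0 0 + E 0 0 ⊗ₜ (f 1 + f 2)]

/-- The comultiplication. -/
def comulMap : KP →ₗ[ℂ] KP ⊗[ℂ] KP where
  toFun a := ∑ i, a.1 i • comulF i + ∑ k, ∑ l, a.2 k l • comulE k l
  map_add' a b := by
    simp only [KP.fst_add, KP.snd_add, Pi.add_apply, Matrix.add_apply, add_smul,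
      Finset.sum_add_distrib]
    abel
  map_smul' c a := by
    simp only [KP.fst_smul, KP.snd_smul, Pi.smul_apply, Matrix.smul_apply, smul_assoc,
      Finset.smul_sum, smul_add, RingHom.id_apply]

@[simp] theorem comulMap_f (i : Fin 4) : comulMap (f i) = comulF i := by
  fin_cases i <;> simp [comulMap, Fin.sum_univ_four]
@[simp] theorem comulMap_E (k l : Fin 2) : comulMap (E k l) = comulE k l := by
  fin_cases k <;> fin_cases l <;> simp [comulMap]

/-- The counit: `ε(f₀) = 1`, and zero on the other basis elements. -/
def counitMap : KP →ₗ[ℂ] ℂ where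
  toFun a := a.1 0
  map_add' _ _ := rfl
  map_smul' _ _ := rfl

/-- The antipode: `S(fᵢ) = fᵢ`, and `S(E_{kl}) = E_{lk}`. -/
def antipodeMap : KP →ₗ[ℂ] KP where
  toFun a := (a.1, a.2.transpose)
  map_add' _ _ := rfl
  map_smul' _ _ := rfl




theorem smul_mul' (r : ℂ) (x y : KP ⊗[ℂ] KP) : (r • x) * y = r • (x * y) := smul_mul_assoc r x y
theorem mul_smul' (r : ℂ) (x y : KP ⊗[ℂ] KP) : x * (r • y) = r • (x * y) := mul_smul_comm r x y


@[simp] theorem antipodeMap_f (i : Fin 4) : antipodeMap (f i) = f i :=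
  KP.ext (fun _ => rfl) fun _ _ => rfl
@[simp] theorem antipodeMap_E (k l : Fin 2) : antipodeMap (E k l) = E l k :=
  KP.ext (fun _ => rfl) fun i j => congrFun (congrFun (Matrix.transpose_single k l 1) i) j
@[simp] theorem counitMap_f (i : Fin 4) : counitMap (f i) = if i = 0 then 1 else 0 := by
  change (Pi.single i 1 : Fin 4 → ℂ) 0 = _
  simp [Pi.single_apply, eq_comm]
@[simp] theorem counitMap_E (k l : Fin 2) : counitMap (E k l) = 0 := rfl

open TensorProduct Algebra.TensorProduct

set_option maxHeartbeats 1000000 in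
theorem comulF_mul_comulF (i j : Fin 4) :
    comulF i * comulF j = if i = j then comulF i else 0 := by
  fin_cases i <;> fin_cases j <;>
  · simp only [comulF, Matrix.cons_val, Fin.isValue, Fin.mk_one, Fin.zero_eta,
      Fin.reduceFinMk, add_mul, mul_add, sub_mul, mul_sub, smul_mul', mul_smul',
      tmul_mul_tmul, f_mul_f, f_mul_E, E_mul_f, E_mul_E, Fin.reduceEq, if_true, if_false,
      zero_tmul, tmul_zero, smul_zero, add_zero, zero_add, sub_zero, zero_sub,
      zero_ne_one, one_ne_zero, smul_add, smul_sub]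
    try (match_scalars <;> first | ring1 | (ring_nf; norm_num [Complex.I_sq]))

set_option maxHeartbeats 1000000 in
theorem comulE_mul_comulE (k l m n : Fin 2) :
    comulE k l * comulE m n = if l = m then comulE k n else 0 := by
  fin_cases k <;> fin_cases l <;> fin_cases m <;> fin_cases n <;>
  · simp only [comulE, Matrix.cons_val, Matrix.of_apply, Fin.isValue, Fin.mk_one,
      Fin.zero_eta, add_mul, mul_add, sub_mul, mul_sub, smul_mul', mul_smul',
      tmul_mul_tmul, f_mul_f, f_mul_E, E_mul_f, E_mul_E, Fin.reduceEq, if_true, if_false,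
      zero_tmul, tmul_zero, smul_zero, add_zero, zero_add, sub_zero, zero_sub,
      zero_ne_one, one_ne_zero, smul_sub, add_tmul, sub_tmul, tmul_add, tmul_sub]
    try (match_scalars <;> first | ring1 | (ring_nf; norm_num [Complex.I_sq]))

theorem comul_sum_eq_one : (∑ i, comulF i) + ∑ k, comulE k k = 1 := by
  simp only [Algebra.TensorProduct.one_def, one_eq, comulF, comulE, Fin.sum_univ_four,
    Fin.sum_univ_two, Matrix.cons_val, Matrix.of_apply, Fin.isValue, add_tmul, tmul_add, smul_add,
    smul_sub]
  module

theorem comulMap_one : comulMap 1 = 1 := by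
  rw [← comul_sum_eq_one, one_eq]
  simp only [map_add, comulMap_f, comulMap_E, Fin.sum_univ_four, Fin.sum_univ_two]
  abel

theorem comulF_mul_comulE (i : Fin 4) (m n : Fin 2) : comulF i * comulE m n = 0 := by
  have h₁ : (∑ i, comulF i) * comulE m n = 0 := by
    have h := congrArg (· * comulE m n) comul_sum_eq_one
    fin_cases m <;> simpa [add_mul, Finset.sum_mul, comulE_mul_comulE] using h
  have h₂ : comulF i * ∑ j, comulF j = comulF i := by
    simp [Finset.mul_sum, comulF_mul_comulF]
  rw [← h₂, mul_assoc, h₁, mul_zero]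

theorem comulE_mul_comulF (i : Fin 4) (m n : Fin 2) : comulE m n * comulF i = 0 := by
  have h₁ : comulE m n * (∑ i, comulF i) = 0 := by
    have h := congrArg (comulE m n * ·) comul_sum_eq_one
    fin_cases n <;> simpa [mul_add, Finset.mul_sum, comulE_mul_comulE] using h
  have h₂ : (∑ j, comulF j) * comulF i = comulF i := by
    simp [Finset.sum_mul, comulF_mul_comulF]
  rw [← h₂, ← mul_assoc, h₁, zero_mul]

theorem comulMap_mul (a b : KP) : comulMap (a * b) = comulMap a * comulMap b := by
  have h : (LinearMap.mul ℂ KP).compr₂ comulMap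
      = (LinearMap.mul ℂ (KP ⊗[ℂ] KP)).compl₁₂ comulMap comulMap := by
    refine linearMap_ext (fun i => linearMap_ext (fun j => ?_) fun m n => ?_)
      (fun k l => linearMap_ext (fun j => ?_) fun m n => ?_) <;>
    simp only [LinearMap.compr₂_apply, LinearMap.compl₁₂_apply, LinearMap.mul_apply', comulMap_f,
      comulMap_E, comulF_mul_comulF, comulF_mul_comulE, comulE_mul_comulF, comulE_mul_comulE,
      f_mul_f, f_mul_E, E_mul_f, E_mul_E, map_zero] <;>
    split_ifs <;> simp
  exact LinearMap.congr_fun₂ h a b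

set_option maxRecDepth 4000 in
set_option maxHeartbeats 4000000 in
theorem comulMap_coassoc : (TensorProduct.assoc ℂ KP KP KP).toLinearMap ∘ₗ
    comulMap.rTensor KP ∘ₗ comulMap = comulMap.lTensor KP ∘ₗ comulMap := by
  refine linearMap_ext (fun i => ?_) (fun i j => ?_)
  · fin_cases i <;>
    · simp only [LinearMap.comp_apply, LinearEquiv.coe_coe, comulMap_f, comulMap_E, comulF, comulE,
        Matrix.cons_val, Matrix.of_apply, Fin.isValue, Fin.mk_one, Fin.zero_eta, Fin.reduceFinMk,
        map_add, map_sub, map_smul, LinearMap.rTensor_tmul, LinearMap.lTensor_tmul, add_tmul,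
        sub_tmul, tmul_add, tmul_sub, tmul_smul, ← smul_tmul', TensorProduct.assoc_tmul, smul_add, smul_sub]
      match_scalars <;> first | ring1 | (ring_nf; norm_num [Complex.I_sq])
  · fin_cases i <;> fin_cases j <;>
    · simp only [LinearMap.comp_apply, LinearEquiv.coe_coe, comulMap_f, comulMap_E, comulF, comulE,
        Matrix.cons_val, Matrix.of_apply, Fin.isValue, Fin.mk_one, Fin.zero_eta,
        map_add, map_sub, map_smul, LinearMap.rTensor_tmul, LinearMap.lTensor_tmul, add_tmul,
        sub_tmul, tmul_add, tmul_sub, tmul_smul, ← smul_tmul', TensorProduct.assoc_tmul, smul_add, smul_sub]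
      match_scalars <;> first | ring1 | (ring_nf; norm_num [Complex.I_sq])

theorem star_f (i : Fin 4) : star (f i) = f i := by
  ext j
  · fin_cases i <;> fin_cases j <;> simp
  · simp

theorem star_E (k l : Fin 2) : star (E k l) = E l k := by
  ext i j
  · simp
  · fin_cases k <;> fin_cases l <;> fin_cases i <;> fin_cases j <;> simp [Matrix.star_apply]

theorem comulMap_star (a : KP) : comulMap (star a) = star (comulMap a) := by
  have hF : ∀ i, star (comulF i) = comulF i := by
    intro i
    fin_cases i <;> simp [comulF, star_f, star_E, neg_div] <;> module
  have hE : ∀ k l, star (comulE k l) = comulE l k := by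
    intro k l
    fin_cases k <;> fin_cases l <;> simp [comulE, star_f, star_E]
    all_goals module
  simp only [comulMap, LinearMap.coe_mk, AddHom.coe_mk, star_add, star_sum, star_smul, hF, hE]
  rw [Finset.sum_comm (s := (Finset.univ : Finset (Fin 2)))]
  rfl

instance : HopfAlgebra ℂ KP where
  comul := comulMap
  counit := counitMap
  coassoc := comulMap_coassoc
  rTensor_counit_comp_comul := by
    refine linearMap_ext (fun i => ?_) (fun i j => ?_)
    · fin_cases i <;> simp [comulF, smul_tmul']
    · fin_cases i <;> fin_cases j <;> simp [comulE]
  lTensor_counit_comp_comul := by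
    refine linearMap_ext (fun i => ?_) (fun i j => ?_)
    · fin_cases i <;> simp [comulF]
    · fin_cases i <;> fin_cases j <;> simp [comulE]
  counit_one := rfl
  mul_compr₂_counit := rfl
  comul_one := comulMap_one
  mul_compr₂_comul := LinearMap.ext₂ comulMap_mul
  antipode := antipodeMap
  mul_antipode_rTensor_comul := by
    refine linearMap_ext (fun i => ?_) (fun i j => ?_)
    · fin_cases i <;> simp [comulF, f_mul_f, E_mul_E,
        Algebra.algebraMap_eq_smul_one, one_eq]
      all_goals module
    · fin_cases i <;> fin_cases j <;> simp [comulE, mul_add, add_mul, sub_mul,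
        mul_sub, f_mul_E, E_mul_f]
  mul_antipode_lTensor_comul := by
    refine linearMap_ext (fun i => ?_) (fun i j => ?_)
    · fin_cases i <;> simp [comulF, f_mul_f, E_mul_E,
        Algebra.algebraMap_eq_smul_one, one_eq]
      all_goals module
    · fin_cases i <;> fin_cases j <;> simp [comulE, mul_add, add_mul, sub_mul,
        mul_sub, f_mul_E, E_mul_f]

/-! ### The transitive magic representations -/

/-- The rank one projection used in `repU`. -/
def p : Matrix (Fin 2) (Fin 2) ℂ :=
  !![1 / 2, 1 / 2 * Complex.exp (-(Real.pi / 4 * I)); 1 / 2 * Complex.exp (Real.pi / 4 * I), 1 / 2]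

open Matrix in
/-- The fundamental magic representation `u^{G₀}`, which gives `G₀ ⊂ S₄⁺`. -/
def repU : Matrix (Fin 4) (Fin 4) KP :=
  !![f 0 + f 1, f 2 + f 3, ofMat p, ofMat (1 - p);
    f 2 + f 3, f 0 + f 1, ofMat (1 - p), ofMat p;
    ofMat pᵀ, ofMat (1 - pᵀ), f 0 + f 2, f 1 + f 3;
    ofMat (1 - pᵀ), ofMat pᵀ, f 1 + f 3, f 0 + f 2]

/-- The magic representation `w`. -/
def repW : Matrix (Fin 4) (Fin 4) KP :=
  !![f 0 + f 3, f 1 + f 2, E 0 0, E 1 1;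
    f 1 + f 2, f 0 + f 3, E 1 1, E 0 0;
    E 0 0, E 1 1, f 0 + f 3, f 1 + f 2;
    E 1 1, E 0 0, f 1 + f 2, f 0 + f 3]

/-- The magic representation `x`. -/
def repX : Matrix (Fin 2) (Fin 2) KP :=
  !![f 0 + f 1 + f 2 + f 3, ofMat 1; ofMat 1, f 0 + f 1 + f 2 + f 3]

/-- The magic representation `y`. -/
def repY : Matrix (Fin 2) (Fin 2) KP :=
  !![f 0 + f 3 + E 0 0, f 1 + f 2 + E 1 1; f 1 + f 2 + E 1 1, f 0 + f 3 + E 0 0]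

/-- The magic representation `z`. -/
def repZ : Matrix (Fin 2) (Fin 2) KP :=
  !![f 0 + f 3 + E 1 1, f 1 + f 2 + E 0 0; f 1 + f 2 + E 0 0, f 0 + f 3 + E 1 1]

/-- The types of blocks: one for each of `u^{G₀}`, `w`, `x`, `y`, `z` and the trivial
representation `1`. -/
inductive BlockType
  | u | w | x | y | z | one

/-- The number of vertices in a block. -/
def BlockType.size : BlockType → ℕ
  | .u => 4
  | .w => 4
  | .x => 2
  | .y => 2
  | .z => 2
  | .one => 1

/-- The magic representation of a block. -/
def BlockType.rep : (b : BlockType) → Matrix (Fin b.size) (Fin b.size) KP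
  | .u => repU
  | .w => repW
  | .x => repX
  | .y => repY
  | .z => repZ
  | .one => 1

/-- A relabelling of the vertices which turns `u` into the block diagonal matrix whose blocks are
`u^{G₀}`, `w`, `x`, `y`, `z`, `1`, with multiplicities. -/
structure BlockLabelling {V : Type*} (u : Matrix V V KP) where
  /-- The number of blocks. -/
  k : ℕ
  /-- The type of each block. -/
  type : Fin k → BlockType
  /-- The relabelling. -/
  label : V ≃ (q : Fin k) × Fin (type q).size
  eq_blockDiagonal : u = (Matrix.blockDiagonal' fun q => (type q).rep).submatrix label label

end

/-! ### The action of `D₄` -/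

open Equiv in
/-- The copy `{e, (12), (34), (12)(34), (13)(24), (14)(23), (1324), (1423)}` of `D₄`, on the points
`0, 1, 2, 3` instead of `1, 2, 3, 4`. -/
def d4List : List (Perm (Fin 4)) :=
  [1, swap 0 1, swap 2 3, swap 0 1 * swap 2 3, swap 0 2 * swap 1 3, swap 0 3 * swap 1 2,
    c[0, 2, 1, 3], c[0, 3, 1, 2]]

/-- `D₄` as a subgroup of `S₄`. -/
def D4 : Subgroup (Equiv.Perm (Fin 4)) where
  carrier := {ω | ω ∈ d4List}
  mul_mem' {a b} ha hb :=
    (by decide : ∀ a ∈ d4List, ∀ b ∈ d4List, a * b ∈ d4List) a ha b hb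
  one_mem' := by simp [d4List]
  inv_mem' {a} ha := (by decide : ∀ a ∈ d4List, a⁻¹ ∈ d4List) a ha

/-- The exponent `b₁` in `ω = (34)^{b₃} (12)^{b₂} s^{b₁}`, where `s = (14)(23)`, is `1` if and only
if `ω` exchanges the sets `{1, 2}` and `{3, 4}`. -/
def crosses (ω : Equiv.Perm (Fin 4)) : Bool := decide (2 ≤ (ω 0).val)

theorem crosses_mul : ∀ a ∈ d4List, ∀ b ∈ d4List, crosses (a * b) = xor (crosses a) (crosses b) := by
  decide

/-- The action of `D₄` through `ω ↦ τ ^ b₁`, for an involution `τ`. -/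
def crossHom {n : ℕ} (τ : Equiv.Perm (Fin n)) (hτ : τ * τ = 1) : D4 →* Equiv.Perm (Fin n) where
  toFun ω := if crosses ω.1 then τ else 1
  map_one' := by simp [crosses]
  map_mul' a b := by
    change (if crosses (a.1 * b.1) = true then τ else 1) = _
    rw [crosses_mul a.1 a.2 b.1 b.2]
    cases crosses a.1 <;> cases crosses b.1 <;> simp [hτ]

open Equiv in
/-- The action of `D₄` on a block: the given one on blocks of type `u^{G₀}`, `(13)(24)^{b₁}` on
blocks of type `w`, `(12)^{b₁}` on blocks of type `x` and `z`, and trivial on the others. -/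
def BlockType.action : (b : BlockType) → D4 →* Perm (Fin b.size)
  | .u => D4.subtype
  | .w => crossHom (n := 4) (swap 0 2 * swap 1 3) (by decide)
  | .x => crossHom (n := 2) (swap 0 1) (by decide)
  | .y => 1
  | .z => crossHom (n := 2) (swap 0 1) (by decide)
  | .one => 1

/-- The action of `D₄` on the vertices, block by block. -/
def BlockLabelling.action {V : Type*} {u : Matrix V V KP} (L : BlockLabelling u) :
    D4 →* Equiv.Perm V where
  toFun ω := (L.label.trans (Equiv.sigmaCongrRight fun q => (L.type q).action ω)).trans L.label.symm
  map_one' := by ext v; simp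
  map_mul' a b := by ext v; simp [Equiv.Perm.mul_apply]

end KacPaljutkin

/-!
Let `h` be the Haar functional of `G₀`, a faithful trace. For a magic representation `u`, the
relation `u i j ≠ 0` is an equivalence relation on the vertices, and invariance of `h` makes
`h (u i j)` constant on each of its classes; on a class with `N` elements, `8 h (u i j)` is an
integer `m` with `N m = 8`. Here `m = 1` is impossible, since a projection of mass `1/8` vanishes in
the summand `M₂(ℂ)`, so that `N` is `1`, `2` or `4`. Applying products of matrix coefficients of
`M₂(ℂ)` to both sides of the coproduct formula for a diagonal entry gives quadratic equations for
the matrix parts of its row, whose only solutions of trace one are `p`, `pᵀ`, `E₁₁` and their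
complements, depending on the central part of the diagonal entry. This determines `u` on each class
up to relabelling.

The entries of all blocks have integer coordinates in one basis which is orthonormal for `8 h`, and
in these coordinates `D₄` acts on the columns of all blocks simultaneously by isometries. Since
`h` is a faithful trace, a product of two projections vanishes exactly when its mass does, so `D₄`
preserves every orbital. Adjacency in a graph on which `G₀` acts is constant on the orbitals, so
`D₄` acts by automorphisms of the graph. But every automorphism of `X` is a character of `C(G⁺(X))`,
and `C(G₀)` has only four characters, fewer than `D₄` has elements.
-/

namespace QuantumAut

section FaithfulPositive

open scoped ComplexOrder

/-- A faithful positive linear functional on a `⋆`-algebra: `0 ≤ h (a⋆ a)`, with equality only for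
`a = 0`. Its existence makes projections behave as they do in a C⋆-algebra, without any norm. -/
structure IsFaithfulPositive {A : Type*} [Ring A] [StarRing A] [Module ℂ A] (h : A →ₗ[ℂ] ℂ) :
    Prop where
  nonneg : ∀ a, 0 ≤ h (star a * a)
  eq_zero : ∀ a, h (star a * a) = 0 → a = 0

theorem IsFaithfulPositive.mul_eq_zero_of_sum_eq_one {A ι : Type*} [Ring A] [StarRing A]
    [Module ℂ A] {h : A →ₗ[ℂ] ℂ} (hh : IsFaithfulPositive h) [Fintype ι] {q : ι → A}
    (hq : ∀ i, IsStarProjection (q i)) (hsum : ∑ i, q i = 1) {i j : ι} (hij : i ≠ j) :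
    q i * q j = 0 := by
  classical
  have star_mul_self (k : ι) : star (q k * q j) * (q k * q j) = q j * q k * q j := by
    rw [star_mul, (hq k).isSelfAdjoint.star_eq, (hq j).isSelfAdjoint.star_eq, mul_assoc,
      ← mul_assoc (q k), (hq k).isIdempotentElem.eq, mul_assoc]
  have sum_erase : ∑ k ∈ Finset.univ.erase j, q j * q k * q j = 0 := by
    have total : ∑ k, q j * q k * q j = q j := by
      rw [← Finset.sum_mul, ← Finset.mul_sum, hsum, mul_one, (hq j).isIdempotentElem.eq]
    rwa [← Finset.add_sum_erase _ _ (Finset.mem_univ j), (hq j).isIdempotentElem.eq,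
      (hq j).isIdempotentElem.eq, add_eq_left] at total
  have sum_h : ∑ k ∈ Finset.univ.erase j, h (star (q k * q j) * (q k * q j)) = 0 := by
    simp only [star_mul_self, ← map_sum, sum_erase, map_zero]
  rw [Finset.sum_eq_zero_iff_of_nonneg fun k _ => hh.nonneg _] at sum_h
  exact hh.eq_zero _ (sum_h i (by simp [hij]))

end FaithfulPositive

section Graph

variable {V A : Type*} [Fintype V] [Ring A] {u : Matrix V V A} {X : SimpleGraph V}

theorem IsMagic.row_mul_eq_zero [StarRing A] [Module ℂ A] {h : A →ₗ[ℂ] ℂ}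
    (hu : IsMagic u) (hh : IsFaithfulPositive h) (i : V) {j k : V} (hjk : j ≠ k) :
    u i j * u i k = 0 :=
  hh.mul_eq_zero_of_sum_eq_one (hu.proj i) (hu.row i) hjk

theorem IsMagic.col_mul_eq_zero [StarRing A] [Module ℂ A] {h : A →ₗ[ℂ] ℂ}
    (hu : IsMagic u) (hh : IsFaithfulPositive h) (k : V) {i j : V} (hij : i ≠ j) :
    u i k * u j k = 0 :=
  hh.mul_eq_zero_of_sum_eq_one (fun i => hu.proj i k) (hu.col k) hij

open Classical in
theorem IsMagic.adj_iff_of_mul_ne_zero [StarRing A] [Module ℂ A] {h : A →ₗ[ℂ] ℂ}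
    (hu : IsMagic u) (hh : IsFaithfulPositive h) (hX : Preserves u X) {i j k l : V}
    (hne : u i j * u k l ≠ 0) : X.Adj i k ↔ X.Adj j l := by
  have left : u i j * (u * X.adjMatrix A) i l * u k l =
      if X.Adj j l then u i j * u k l else 0 := by
    rw [Matrix.mul_apply, Finset.mul_sum, Finset.sum_eq_single j]
    · simp [SimpleGraph.adjMatrix_apply, (hu.proj i j).isIdempotentElem.eq]
    · intro m _ hm
      rw [← mul_assoc, hu.row_mul_eq_zero hh i hm.symm, zero_mul]
    · simp
  have right : u i j * ((X.adjMatrix A * u) i l * u k l) =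
      if X.Adj i k then u i j * u k l else 0 := by
    rw [Matrix.mul_apply, Finset.sum_mul, Finset.sum_eq_single k]
    · simp [SimpleGraph.adjMatrix_apply, (hu.proj k l).isIdempotentElem.eq]
    · intro m _ hm
      rw [mul_assoc, hu.col_mul_eq_zero hh l hm, mul_zero]
    · simp
  have hX' : X.adjMatrix A * u = u * X.adjMatrix A := hX
  rw [hX', ← mul_assoc, left] at right
  by_cases hik : X.Adj i k <;> by_cases hjl : X.Adj j l <;> simp_all

theorem preserves_map_iff {B : Type*} [Ring B] (φ : A →+* B) (hφ : Function.Injective φ) :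
    Preserves (u.map φ) X ↔ Preserves u X := by
  classical
  have adjMatrix_map : X.adjMatrix B = (X.adjMatrix A).map φ := by
    ext i j
    simp [SimpleGraph.adjMatrix_apply, apply_ite φ]
  simp only [Preserves]
  rw [adjMatrix_map, ← Matrix.map_mul, ← Matrix.map_mul]
  exact (Matrix.map_injective hφ).eq_iff

theorem isMagic_permMatrix [StarRing A] [DecidableEq V] (σ : Equiv.Perm V) :
    IsMagic (σ.permMatrix A) where
  proj i j := by
    rw [Equiv.Perm.permMatrix, PEquiv.toMatrix_apply]
    split_ifs
    exacts [.one _, .zero _]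
  row i := by simp [Equiv.Perm.permMatrix, PEquiv.toMatrix_apply]
  col j := by simp [Equiv.Perm.permMatrix, PEquiv.toMatrix_apply, ← Equiv.eq_symm_apply]

theorem preserves_permMatrix [DecidableEq V] (σ : X ≃g X) :
    Preserves (Equiv.Perm.permMatrix A σ.toEquiv) X := by
  classical
  rw [Preserves, Equiv.Perm.permMatrix, PEquiv.mul_toMatrix_toPEquiv,
    PEquiv.toMatrix_toPEquiv_mul]
  ext i j
  have := σ.map_adj_iff (v := i) (w := σ.symm j)
  rw [RelIso.apply_symm_apply] at this
  exact if_congr this.symm rfl rfl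

end Graph

section Woronowicz

variable {V B C : Type*} [Fintype V] [Ring B] [StarRing B] [Algebra ℂ B] [StarModule ℂ B]
  [Ring C] [StarRing C] [Algebra ℂ C] [StarModule ℂ C] {u : Matrix V V B} {v : Matrix V V C}
  {X : SimpleGraph V}

theorem SameWoronowicz.preserves (h : SameWoronowicz u v) (hu : Preserves u X) :
    Preserves v X := by
  obtain ⟨φ, hφ⟩ := h
  let U : Matrix V V (StarAlgebra.adjoin ℂ (entries u)) := Matrix.of fun i j =>
    ⟨u i j, StarAlgebra.subset_adjoin ℂ _ ⟨(i, j), rfl⟩⟩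
  have hU : Preserves U X := (preserves_map_iff
    (StarAlgebra.adjoin ℂ (entries u)).subtype.toRingHom Subtype.val_injective).mp hu
  have hv : v = (U.map (φ : _ →+* _)).map
      (StarAlgebra.adjoin ℂ (entries v)).subtype.toRingHom :=
    Matrix.ext fun i j => (hφ i j).symm
  rw [hv]
  exact (preserves_map_iff _ Subtype.val_injective).mpr
    ((preserves_map_iff _ φ.injective).mpr hU)

theorem SameWoronowicz.exists_algHom [DecidableEq V] (h : SameWoronowicz (fund X) v)
    (hv : StarAlgebra.adjoin ℂ (entries v) = ⊤) (σ : X ≃g X) :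
    ∃ χ : C →ₐ[ℂ] ℂ, ∀ i j, χ (v i j) = Equiv.Perm.permMatrix ℂ σ.toEquiv i j := by
  obtain ⟨φ, hφ⟩ := h
  obtain ⟨ψ, hψ, -⟩ :=
    existsUnique_hom X ℂ _ (isMagic_permMatrix σ.toEquiv) (preserves_permMatrix σ)
  let ι : C →⋆ₐ[ℂ] StarAlgebra.adjoin ℂ (entries v) :=
    (StarAlgHom.id ℂ C).codRestrict _ fun a => hv ▸ StarSubalgebra.mem_top
  let χ : C →⋆ₐ[ℂ] ℂ :=
    (ψ.comp (StarSubalgebra.subtype _)).comp ((StarAlgHomClass.toStarAlgHom φ.symm).comp ι)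
  refine ⟨χ.toAlgHom, fun i j => ?_⟩
  have hfund : φ.symm (ι (v i j)) =
      ⟨fund X i j, StarAlgebra.subset_adjoin ℂ _ ⟨(i, j), rfl⟩⟩ := by
    rw [StarAlgEquiv.symm_apply_eq]
    exact Subtype.ext (hφ i j).symm
  change ψ (φ.symm (ι (v i j)) : QAutAlg X) = _
  rw [hfund]
  exact hψ i j

theorem SameWoronowicz.card_aut_le_card_algHom [Finite (C →ₐ[ℂ] ℂ)]
    (h : SameWoronowicz (fund X) v) (hv : StarAlgebra.adjoin ℂ (entries v) = ⊤) :
    Nat.card (X ≃g X) ≤ Nat.card (C →ₐ[ℂ] ℂ) := by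
  classical
  choose χ hχ using h.exists_algHom hv
  refine Nat.card_le_card_of_injective χ fun σ τ hστ => RelIso.ext fun i => ?_
  have := hχ τ i (σ i)
  rw [← hστ, hχ] at this
  simpa [Equiv.Perm.permMatrix, PEquiv.toMatrix_apply, eq_comm] using this

end Woronowicz

/-! ### Magic representations of finite quantum groups -/

section Trace

variable {A : Type*} [Ring A] [StarRing A] [Module ℂ A] {h : A →ₗ[ℂ] ℂ} {a b : A}

theorem IsFaithfulPositive.mul_eq_zero_iff (hh : IsFaithfulPositive h)
    (hcomm : ∀ a b, h (a * b) = h (b * a)) (ha : IsStarProjection a) (hb : IsStarProjection b) :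
    a * b = 0 ↔ h (a * b) = 0 := by
  refine ⟨fun hab => by rw [hab, map_zero], fun hab => hh.eq_zero _ ?_⟩
  rw [star_mul, ha.isSelfAdjoint.star_eq, hb.isSelfAdjoint.star_eq, mul_assoc, ← mul_assoc a,
    ha.isIdempotentElem.eq, hcomm, mul_assoc, hb.isIdempotentElem.eq, hab]

theorem IsFaithfulPositive.eq_zero_iff (hh : IsFaithfulPositive h) (ha : IsStarProjection a) :
    a = 0 ↔ h a = 0 := by
  refine ⟨fun ha => by rw [ha, map_zero], fun h0 => hh.eq_zero a ?_⟩
  rwa [ha.isSelfAdjoint.star_eq, ha.isIdempotentElem.eq]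

end Trace

section Transpose

open Matrix

variable {V A : Type*} [Fintype V] [DecidableEq V] [Ring A] [StarRing A] [Module ℂ A]
  {h : A →ₗ[ℂ] ℂ} {u : Matrix V V A}

theorem IsMagic.transpose_mul_self (hu : IsMagic u) (hh : IsFaithfulPositive h) :
    uᵀ * u = 1 := by
  ext i j
  simp only [Matrix.mul_apply, Matrix.transpose_apply, Matrix.one_apply]
  split_ifs with hij
  · simp only [hij, (hu.proj _ _).isIdempotentElem.eq, hu.col]
  · exact Finset.sum_eq_zero fun k _ => hu.row_mul_eq_zero hh k hij

theorem IsMagic.mul_transpose_self (hu : IsMagic u) (hh : IsFaithfulPositive h) :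
    u * uᵀ = 1 := by
  ext i j
  simp only [Matrix.mul_apply, Matrix.transpose_apply, Matrix.one_apply]
  split_ifs with hij
  · simp only [hij, (hu.proj _ _).isIdempotentElem.eq, hu.row]
  · exact Finset.sum_eq_zero fun k _ => hu.col_mul_eq_zero hh k hij

end Transpose

section MagicRep

open Coalgebra HopfAlgebra Matrix

variable {V A : Type*} [Fintype V] [Ring A] [StarRing A] [HopfAlgebra ℂ A]

/-- A magic representation, i.e. a morphism `G → S_N⁺`, which unlike an embedding may forget part of
`G`: the entries need not generate `A = C(G)`. -/
structure IsMagicRep (u : Matrix V V A) : Prop where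
  magic : IsMagic u
  comul : ∀ i j, comul (R := ℂ) (u i j) = ∑ k, u i k ⊗ₜ[ℂ] u k j

/-- The Haar functional of a finite quantum group: a faithful positive functional which is
normalised and invariant. On a finite quantum group it is moreover a trace and invariant under the
antipode, and we make this part of the definition. -/
structure IsHaarTrace (h : A →ₗ[ℂ] ℂ) : Prop extends IsFaithfulPositive h where
  map_one : h 1 = 1
  map_mul_comm : ∀ a b, h (a * b) = h (b * a)
  map_antipode : ∀ a, h (antipode ℂ a) = h a
  invariant : ∀ a, TensorProduct.rid ℂ A (h.lTensor A (comul a)) = h a • 1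

theorem IsFundamentalMagicRep.isMagicRep [StarModule ℂ A] {u : Matrix V V A}
    (hu : IsFundamentalMagicRep u) : IsMagicRep u :=
  ⟨hu.magic, hu.comul⟩

namespace IsMagicRep

variable {h : A →ₗ[ℂ] ℂ} {u : Matrix V V A}

theorem counit [DecidableEq V] (hu : IsMagicRep u) (hh : IsFaithfulPositive h) (i j : V) :
    counit (R := ℂ) (u i j) = if i = j then 1 else 0 := by
  let ε : Matrix V V A := u.map fun a => algebraMap ℂ A (Coalgebra.counit a)
  have mul_counit : u * ε = u := by
    ext i j
    have := congrArg (TensorProduct.rid ℂ A) (lTensor_counit_comul (R := ℂ) (u i j))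
    rw [hu.comul] at this
    simpa [ε, Matrix.mul_apply, Algebra.algebraMap_eq_smul_one] using this
  have counit_eq_one : ε = 1 := by
    rw [← hu.magic.transpose_mul_self hh, ← mul_counit, ← mul_assoc, mul_counit,
      hu.magic.transpose_mul_self hh, one_mul]
  have := congrArg (Coalgebra.counit (R := ℂ)) (congrFun₂ counit_eq_one i j)
  simpa [ε, Matrix.one_apply, apply_ite] using this

theorem antipode (hu : IsMagicRep u) (hh : IsFaithfulPositive h) (i j : V) :
    HopfAlgebra.antipode ℂ (u i j) = u j i := by
  classical
  let S : Matrix V V A := u.map (HopfAlgebra.antipode ℂ)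
  have antipode_mul : S * u = 1 := by
    ext i j
    have := mul_antipode_rTensor_comul_apply (R := ℂ) (u i j)
    rw [hu.comul, hu.counit hh] at this
    simpa [S, Matrix.mul_apply, Matrix.one_apply, apply_ite] using this
  have antipode_eq_transpose : S = uᵀ := by
    rw [← mul_one S, ← hu.magic.mul_transpose_self hh, ← mul_assoc, antipode_mul, one_mul]
  exact congrFun₂ antipode_eq_transpose i j

theorem haar_swap (hu : IsMagicRep u) (hh : IsHaarTrace h) (i j : V) : h (u i j) = h (u j i) := by
  rw [← hu.antipode hh.toIsFaithfulPositive i j, hh.map_antipode]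

theorem haar_eq_of_ne_zero (hu : IsMagicRep u) (hh : IsHaarTrace h) {i k : V} (hik : u i k ≠ 0)
    (j : V) : h (u i j) = h (u k j) := by
  have invariant := hh.invariant (u i j)
  rw [hu.comul] at invariant
  simp only [map_sum, LinearMap.lTensor_tmul, TensorProduct.rid_tmul] at invariant
  have times := congrArg (u i k * ·) invariant
  simp only [Finset.mul_sum, mul_smul_comm, mul_one] at times
  rw [Finset.sum_eq_single k, (hu.magic.proj _ _).isIdempotentElem.eq] at times
  · exact (smul_left_injective ℂ hik times).symm
  · intro l _ hl
    rw [hu.magic.row_mul_eq_zero hh.toIsFaithfulPositive i hl.symm, smul_zero]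
  · simp

theorem self_mul_self_ne_zero (hu : IsMagicRep u) (hh : IsFaithfulPositive h) (i j : V) :
    u i i * u j j ≠ 0 := fun h0 => by
  classical
  have := congrArg (Coalgebra.counit (R := ℂ)) h0
  simp [hu.counit hh] at this

theorem self_ne_zero (hu : IsMagicRep u) (hh : IsFaithfulPositive h) (i : V) : u i i ≠ 0 :=
  left_ne_zero_of_mul (hu.self_mul_self_ne_zero hh i i)

/-- The orbits of a magic representation: `i ∼ j` if and only if `u_{ij} ≠ 0`. -/
def orbitSetoid (hu : IsMagicRep u) (hh : IsHaarTrace h) : Setoid V where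
  r i j := u i j ≠ 0
  iseqv :=
    have haar_ne_zero {i j : V} : h (u i j) ≠ 0 ↔ u i j ≠ 0 :=
      (hh.eq_zero_iff (hu.magic.proj i j)).not.symm
    { refl := hu.self_ne_zero hh.toIsFaithfulPositive
      symm := fun hij => by rwa [← haar_ne_zero, hu.haar_swap hh, haar_ne_zero]
      trans := fun hij hjk => by
        rwa [← haar_ne_zero, hu.haar_eq_of_ne_zero hh hij, haar_ne_zero] }

theorem submatrix (hu : IsMagicRep u) {O : Type*} [Fintype O] {g : O → V}
    (hg : Function.Injective g) (hrow : ∀ a, ∀ i ∉ Set.range g, u (g a) i = 0)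
    (hcol : ∀ a, ∀ i ∉ Set.range g, u i (g a) = 0) : IsMagicRep (u.submatrix g g) := by
  classical
  have sum_range {M : Type _} [AddCommMonoid M] (F : V → M) (hF : ∀ i ∉ Set.range g, F i = 0) :
      ∑ a, F (g a) = ∑ i, F i := by
    rw [← Finset.sum_image (s := Finset.univ) (g := g) (f := F) hg.injOn]
    exact Finset.sum_subset (Finset.subset_univ _) fun i _ hi => hF i (by simpa using hi)
  refine ⟨⟨fun a b => hu.magic.proj _ _, fun a => ?_, fun b => ?_⟩, fun a b => ?_⟩
  · exact (sum_range (u (g a)) (hrow a)).trans (hu.magic.row _)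
  · exact (sum_range (fun i => u i (g b)) (hcol b)).trans (hu.magic.col _)
  · refine (hu.comul _ _).trans (sum_range (fun i => u (g a) i ⊗ₜ[ℂ] u i (g b)) fun i hi => ?_).symm
    rw [hrow a i hi, TensorProduct.zero_tmul]

theorem submatrix_equiv (hu : IsMagicRep u) {W : Type*} [Fintype W] (e : W ≃ V) :
    IsMagicRep (u.submatrix e e) :=
  hu.submatrix e.injective (fun _ i hi => (hi (e.surjective i)).elim)
    fun _ i hi => (hi (e.surjective i)).elim

theorem card_mul_haar (hu : IsMagicRep u) (hh : IsHaarTrace h) (hne : ∀ i j, u i j ≠ 0)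
    (i j : V) : Fintype.card V * h (u i j) = 1 := by
  have haar_const (k : V) : h (u i k) = h (u i j) := by
    rw [hu.haar_swap hh i k, hu.haar_eq_of_ne_zero hh (hne k j), hu.haar_swap hh j i]
  have sum_haar := congrArg h (hu.magic.row i)
  rw [map_sum, hh.map_one] at sum_haar
  simpa [haar_const] using sum_haar

end IsMagicRep

end MagicRep

section Orbitals

variable {V A : Type*} [Ring A] {u : Matrix V V A} {σ : Equiv.Perm V}

/-- A permutation of the vertices which maps every orbital of `u` onto itself, expressed through
the orbital relation. -/
def PreservesOrbitals (u : Matrix V V A) (σ : Equiv.Perm V) : Prop :=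
  ∀ a b, OrbitalRel u a (Prod.map σ σ b) ↔ OrbitalRel u a b

theorem PreservesOrbitals.image_eq (hσ : PreservesOrbitals u σ) {o : Set (V × V)}
    (ho : IsOrbital u o) : Prod.map σ σ '' o = o := by
  obtain ⟨a, rfl⟩ := ho
  refine Set.Subset.antisymm (Set.image_subset_iff.mpr fun b hb => (hσ a b).mpr hb) fun b hb => ?_
  obtain ⟨c, rfl⟩ := (σ.surjective.prodMap σ.surjective) b
  exact ⟨c, (hσ a c).mp hb, rfl⟩

theorem PreservesOrbitals.adj_iff [Fintype V] [StarRing A] [HopfAlgebra ℂ A] {h : A →ₗ[ℂ] ℂ}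
    (hσ : PreservesOrbitals u σ) (hu : IsMagicRep u) (hh : IsFaithfulPositive h)
    {X : SimpleGraph V} (hX : Preserves u X) (i j : V) : X.Adj (σ i) (σ j) ↔ X.Adj i j :=
  (hu.magic.adj_iff_of_mul_ne_zero hh hX
    ((hσ (i, j) (i, j)).mpr (hu.self_mul_self_ne_zero hh i j))).symm

end Orbitals

end QuantumAut

namespace KacPaljutkin

open Complex (I)
open QuantumAut Matrix

noncomputable section

/-! ### Characters and Haar functional of `G₀` -/

section Character

/-- The character of `C(G₀)` given by the `i`-th copy of `ℂ`. -/
def character (i : Fin 4) : KP →ₐ[ℂ] ℂ where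
  toFun a := a.1 i
  map_one' := rfl
  map_mul' _ _ := rfl
  map_zero' := rfl
  map_add' _ _ := rfl
  commutes' _ := rfl

theorem character_f (i j : Fin 4) : character i (f j) = if i = j then 1 else 0 :=
  Pi.single_apply j 1 i

theorem character_E (i : Fin 4) (k l : Fin 2) : character i (E k l) = 0 := rfl

theorem character_injective : Function.Injective character := fun i j hij => by
  simpa [character_f, eq_comm] using DFunLike.congr_fun hij (f i)

theorem algHom_E (χ : KP →ₐ[ℂ] ℂ) (k l : Fin 2) : χ (E k l) = 0 := by
  have off_diagonal {m n : Fin 2} (hmn : m ≠ n) : χ (E m n) = 0 := by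
    have := map_mul χ (E m n) (E m n)
    rw [E_mul_E, if_neg hmn.symm, map_zero] at this
    exact mul_self_eq_zero.mp this.symm
  rcases ne_or_eq k l with hkl | rfl
  · exact off_diagonal hkl
  · obtain ⟨m, hm⟩ : ∃ m, m ≠ k := exists_ne k
    simpa [E_mul_E, off_diagonal hm] using map_mul χ (E k m) (E m k)

theorem algHom_ext {χ ψ : KP →ₐ[ℂ] ℂ} (h : ∀ i, χ (f i) = ψ (f i)) : χ = ψ :=
  AlgHom.toLinearMap_injective
    (linearMap_ext h fun k l => (algHom_E χ k l).trans (algHom_E ψ k l).symm)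

theorem character_surjective : Function.Surjective character := by
  intro χ
  have sum_eq_one : χ (f 0) + χ (f 1) + χ (f 2) + χ (f 3) = 1 := by
    simpa only [one_eq, map_add, algHom_E, add_zero] using map_one χ
  obtain ⟨i, hi⟩ : ∃ i, χ (f i) ≠ 0 := by
    by_contra! h
    simp [h] at sum_eq_one
  refine ⟨i, algHom_ext fun j => mul_left_cancel₀ hi ?_⟩
  rw [character_f, ← map_mul, f_mul_f]
  split_ifs <;> simp

theorem natCard_algHom : Nat.card (KP →ₐ[ℂ] ℂ) = 4 := by
  rw [← Nat.card_congr (Equiv.ofBijective _ ⟨character_injective, character_surjective⟩),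
    Nat.card_fin]

theorem natCard_classicalVersion : Nat.card (ClassicalVersion KP) = 4 := by
  rw [Nat.card_congr (WithConv.equiv _), natCard_algHom]

theorem classicalVersion_mul_self (χ : ClassicalVersion KP) : χ * χ = 1 := by
  obtain ⟨i, hi⟩ := character_surjective χ.ofConv
  refine WithConv.ofConv_injective (algHom_ext fun j => ?_)
  refine (AlgHom.convMul_apply χ χ (f j)).trans (.trans ?_ (AlgHom.convOne_apply (f j)).symm)
  rw [← hi, show Coalgebra.comul (R := ℂ) (f j) = comulF j from comulMap_f j,
    show Coalgebra.counit (R := ℂ) (f j) = _ from counitMap_f j]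
  fin_cases i <;> fin_cases j <;> simp [comulF, character_f, character_E]

theorem nonempty_classicalVersion_mulEquiv :
    Nonempty (ClassicalVersion KP ≃* Multiplicative (ZMod 2 × ZMod 2)) := by
  let : Group (ClassicalVersion KP) :=
    { (inferInstance : Monoid (ClassicalVersion KP)) with
      inv := id
      inv_mul_cancel := classicalVersion_mul_self }
  have : Finite (ClassicalVersion KP) :=
    Nat.finite_of_card_ne_zero (by rw [natCard_classicalVersion]; norm_num)
  have : Nontrivial (ClassicalVersion KP) :=
    Finite.one_lt_card_iff_nontrivial.mp (by rw [natCard_classicalVersion]; norm_num)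
  have : IsKleinFour (ClassicalVersion KP) :=
    ⟨natCard_classicalVersion, Monoid.exponent_eq_prime_iff Nat.prime_two |>.mpr fun χ hχ =>
      orderOf_eq_prime ((pow_two χ).trans (classicalVersion_mul_self χ)) hχ⟩
  obtain ⟨e⟩ := IsKleinFour.nonempty_mulEquiv (G₁ := ClassicalVersion KP)
    (G₂ := Multiplicative (ZMod 2 × ZMod 2))
  exact ⟨e⟩

end Character

section Haar

open scoped ComplexOrder Matrix

/-- The Haar functional of `G₀`, in which each `fᵢ` has mass `1/8` and each minimal projection of
`M₂(ℂ)` has mass `1/4`. -/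
def haar : KP →ₗ[ℂ] ℂ where
  toFun a := (∑ i, a.1 i) / 8 + a.2.trace / 4
  map_add' a b := by
    simp only [KP.fst_add, KP.snd_add, Pi.add_apply, Finset.sum_add_distrib, Matrix.trace_add]
    ring
  map_smul' c a := by
    simp only [KP.fst_smul, KP.snd_smul, Pi.smul_apply, Matrix.trace_smul, smul_eq_mul,
      ← Finset.mul_sum, RingHom.id_apply]
    ring

theorem haar_apply (a : KP) : haar a = (∑ i, a.1 i) / 8 + a.2.trace / 4 := rfl

theorem haar_f (i : Fin 4) : haar (f i) = 1 / 8 := by simp [haar_apply]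

theorem haar_E (k l : Fin 2) : haar (E k l) = if k = l then 1 / 4 else 0 := by
  fin_cases k <;> fin_cases l <;> simp [haar_apply, Matrix.trace]

theorem haar_star_mul_self (a : KP) :
    haar (star a * a) = (star a.1 ⬝ᵥ a.1) / 8 + (a.2ᴴ * a.2).trace / 4 := rfl

theorem isFaithfulPositive_haar : IsFaithfulPositive haar := by
  have fst_nonneg (a : KP) : 0 ≤ (star a.1 ⬝ᵥ a.1) / 8 :=
    div_nonneg (dotProduct_star_self_nonneg _) (by norm_num)
  have snd_nonneg (a : KP) : 0 ≤ (a.2ᴴ * a.2).trace / 4 :=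
    div_nonneg (Matrix.posSemidef_conjTranspose_mul_self _).trace_nonneg (by norm_num)
  refine ⟨fun a => ?_, fun a ha => ?_⟩ <;> rw [haar_star_mul_self] at *
  · exact add_nonneg (fst_nonneg a) (snd_nonneg a)
  · rw [add_eq_zero_iff_of_nonneg (fst_nonneg a) (snd_nonneg a)] at ha
    exact Prod.ext (dotProduct_star_self_eq_zero.mp (by simpa using ha.1))
      (Matrix.trace_conjTranspose_mul_self_eq_zero_iff.mp (by simpa using ha.2))

theorem haar_invariant (a : KP) :
    TensorProduct.rid ℂ KP (haar.lTensor KP (comulMap a)) = haar a • 1 := by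
  have invariant_f (i : Fin 4) :
      TensorProduct.rid ℂ KP (haar.lTensor KP (comulMap (f i))) = haar (f i) • 1 := by
    fin_cases i <;> simp [comulF, haar_f, haar_E, one_eq] <;> module
  have invariant_E (k l : Fin 2) :
      TensorProduct.rid ℂ KP (haar.lTensor KP (comulMap (E k l))) = haar (E k l) • 1 := by
    fin_cases k <;> fin_cases l <;> simp [comulE, haar_f, haar_E, one_eq] <;> module
  rw [eq_sum a]
  simp only [map_add, map_sum, map_smul, invariant_f, invariant_E, add_smul, Finset.sum_smul,
    smul_assoc]

theorem isHaarTrace_haar : IsHaarTrace haar where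
  toIsFaithfulPositive := isFaithfulPositive_haar
  map_one := by
    rw [haar_apply, show (1 : KP) = (1, 1) from rfl]
    norm_num
  map_mul_comm a b := by
    simp only [haar_apply, KP.fst_mul, KP.snd_mul, mul_comm a.1, Matrix.trace_mul_comm a.2]
  map_antipode a := congrArg (fun t => (∑ i, a.1 i) / 8 + t / 4) (Matrix.trace_transpose a.2)
  invariant := haar_invariant

end Haar

/-! ### Entries of magic representations of `G₀` -/

section Projections

/-- The sum of the minimal central projections `fᵢ` over `i ∈ S`. -/
def chi (S : Finset (Fin 4)) : KP := ∑ i ∈ S, f i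

theorem chi_fst_apply (S : Finset (Fin 4)) (i : Fin 4) :
    (chi S).1 i = if i ∈ S then 1 else 0 := by
  have : (chi S).1 = ∑ j ∈ S, (f j).1 := map_sum (AddMonoidHom.fst (Fin 4 → ℂ) _) f S
  simp [this, Finset.sum_apply, Pi.single_apply]

theorem chi_snd (S : Finset (Fin 4)) : (chi S).2 = 0 :=
  (map_sum (AddMonoidHom.snd (Fin 4 → ℂ) _) f S).trans (Finset.sum_eq_zero fun _ _ => rfl)

theorem chi_pair {i j : Fin 4} (hij : i ≠ j) : chi {i, j} = f i + f j := Finset.sum_pair hij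

theorem chi_compl_fst (S : Finset (Fin 4)) : (chi Sᶜ).1 = 1 - (chi S).1 := by
  ext i
  by_cases hi : i ∈ S <;> simp [chi_fst_apply, hi]

theorem eight_mul_haar (a : KP) : 8 * haar a = ∑ i, a.1 i + 2 * a.2.trace := by
  rw [haar_apply]
  ring

theorem eq_zero_or_eq_one_or_trace_eq_one {K : Type*} [Field K] {P : Matrix (Fin 2) (Fin 2) K}
    (hP : IsIdempotentElem P) : P = 0 ∨ P = 1 ∨ P.trace = 1 := by
  rcases eq_or_ne P.trace 1 with htr | htr
  · exact .inr (.inr htr)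
  have cayley_hamilton : (P.trace - 1) • P = P.det • (1 : Matrix (Fin 2) (Fin 2) K) := by
    have : P.adjugate = P.trace • 1 - P := by
      rw [adjugate_fin_two, trace_fin_two]
      ext i j
      fin_cases i <;> fin_cases j <;> simp
    rw [← mul_adjugate, this, mul_sub, hP.eq, mul_smul_comm, mul_one, sub_smul, one_smul]
  obtain ⟨c, rfl⟩ : ∃ c : K, P = c • 1 :=
    ⟨(P.trace - 1)⁻¹ * P.det, by
      rw [mul_smul, ← cayley_hamilton, inv_smul_smul₀ (sub_ne_zero.mpr htr)]⟩
  have idempotent : c * c = c := by simpa using congrFun₂ hP.eq 0 0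
  rcases IsIdempotentElem.iff_eq_zero_or_one.mp idempotent with rfl | rfl
  · exact .inl (zero_smul K _)
  · exact .inr (.inl (one_smul K _))

theorem exists_fst_eq_chi {a : KP} (ha : IsStarProjection a) : ∃ S, a.1 = (chi S).1 := by
  refine ⟨Finset.univ.filter (a.1 · = 1), funext fun i => ?_⟩
  have : a.1 i * a.1 i = a.1 i := congrFun (congrArg Prod.fst ha.isIdempotentElem.eq) i
  rcases IsIdempotentElem.iff_eq_zero_or_one.mp this with hi | hi <;> simp [chi_fst_apply, hi]

theorem snd_cases {a : KP} (ha : IsStarProjection a) : a.2 = 0 ∨ a.2 = 1 ∨ a.2.trace = 1 :=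
  eq_zero_or_eq_one_or_trace_eq_one (congrArg Prod.snd ha.isIdempotentElem.eq)

theorem exists_support_rank {a : KP} (ha : IsStarProjection a) :
    ∃ (S : Finset (Fin 4)) (r : ℕ), a.1 = (chi S).1 ∧ 8 * haar a = ((S.card + 2 * r : ℕ) : ℂ) ∧
      (r = 0 ∧ a.2 = 0 ∨ r = 1 ∧ a.2.trace = 1 ∨ r = 2 ∧ a.2 = 1) := by
  obtain ⟨S, haS⟩ := exists_fst_eq_chi ha
  have haar_eq : 8 * haar a = S.card + 2 * a.2.trace := by
    simp [eight_mul_haar, haS, chi_fst_apply]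
  rcases snd_cases ha with h | h | h
  · exact ⟨S, 0, haS, by simp [haar_eq, h], .inl ⟨rfl, h⟩⟩
  · exact ⟨S, 2, haS, by norm_num [haar_eq, h], .inr (.inr ⟨rfl, h⟩)⟩
  · exact ⟨S, 1, haS, by simp [haar_eq, h], .inr (.inl ⟨rfl, h⟩)⟩

theorem snd_eq_zero_of_eight_mul_haar_eq_one {a : KP} (ha : IsStarProjection a)
    (h8 : 8 * haar a = 1) : a.2 = 0 := by
  obtain ⟨S, r, -, haar_eq, h⟩ := exists_support_rank ha
  have : S.card + 2 * r = 1 := by exact_mod_cast haar_eq.symm.trans h8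
  exact (h.resolve_right (by lia)).2

theorem snd_eq_zero_or_trace_eq_one_of_eight_mul_haar_eq_two {a : KP} (ha : IsStarProjection a)
    (h8 : 8 * haar a = 2) : a.2 = 0 ∨ a.1 = 0 ∧ a.2.trace = 1 := by
  obtain ⟨S, r, haS, haar_eq, ⟨rfl, h⟩ | ⟨rfl, h⟩ | ⟨rfl, -⟩⟩ := exists_support_rank ha
  · exact .inl h
  · have : S.card + 2 * 1 = 2 := by exact_mod_cast haar_eq.symm.trans h8
    obtain rfl : S = ∅ := Finset.card_eq_zero.mp (by lia)
    exact .inr ⟨haS, h⟩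
  · have : S.card + 2 * 2 = 2 := by exact_mod_cast haar_eq.symm.trans h8
    lia

theorem fst_eq_one_or_trace_eq_one_of_eight_mul_haar_eq_four {a : KP} (ha : IsStarProjection a)
    (h0 : a.1 0 = 1) (h8 : 8 * haar a = 4) :
    a.1 = 1 ∧ a.2 = 0 ∨ ∑ i, a.1 i = 2 ∧ a.2.trace = 1 := by
  obtain ⟨S, r, haS, haar_eq, h⟩ := exists_support_rank ha
  have card_add : S.card + 2 * r = 4 := by exact_mod_cast haar_eq.symm.trans h8
  rw [eight_mul_haar] at h8
  rcases h with ⟨rfl, h⟩ | ⟨-, h⟩ | ⟨rfl, -⟩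
  · obtain rfl : S = Finset.univ := Finset.eq_univ_of_card S (by simpa using card_add)
    exact .inl ⟨haS.trans (funext fun i => by simp [chi_fst_apply]), h⟩
  · exact .inr ⟨by linear_combination h8 - 2 * h, h⟩
  · obtain rfl : S = ∅ := Finset.card_eq_zero.mp (by lia)
    simp [haS, chi_fst_apply] at h0

theorem exists_fst_eq_chi_pair {a : KP} (ha : IsStarProjection a) (h0 : a.1 0 = 1)
    (hsum : ∑ i, a.1 i = 2) : ∃ s ≠ 0, a.1 = (chi {0, s}).1 := by
  obtain ⟨S, haS⟩ := exists_fst_eq_chi ha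
  have card_eq : S.card = 2 := by
    have : (S.card : ℂ) = 2 := by simpa [haS, chi_fst_apply] using hsum
    exact_mod_cast this
  have zero_mem : 0 ∈ S := by
    by_contra h
    simp [haS, chi_fst_apply, h] at h0
  obtain ⟨s, hs, rfl⟩ : ∃ s ≠ 0, S = {0, s} := by
    clear haS
    revert S
    decide
  exact ⟨s, hs, haS⟩

end Projections

section Coproduct

/-- The matrix coefficient `(k, l)` on the summand `M₂(ℂ)`. -/
def matCoord (k l : Fin 2) : KP →ₗ[ℂ] ℂ where
  toFun a := a.2 k l
  map_add' _ _ := rfl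
  map_smul' _ _ := rfl

theorem matCoord_f (k l : Fin 2) (i : Fin 4) : matCoord k l (f i) = 0 := rfl

theorem matCoord_E (k l m n : Fin 2) :
    matCoord k l (E m n) = if m = k ∧ n = l then 1 else 0 :=
  Matrix.single_apply (c := (1 : ℂ)) m n k l

/-- The product of two linear functionals, as a functional on `C(G₀) ⊗ C(G₀)`. -/
def pairing (φ ψ : KP →ₗ[ℂ] ℂ) : KP ⊗[ℂ] KP →ₗ[ℂ] ℂ :=
  LinearMap.mul' ℂ ℂ ∘ₗ TensorProduct.map φ ψ

@[simp] theorem pairing_tmul (φ ψ : KP →ₗ[ℂ] ℂ) (a b : KP) :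
    pairing φ ψ (a ⊗ₜ b) = φ a * ψ b := rfl

theorem pairing_matCoord_comulE (k l m n r s : Fin 2) :
    pairing (matCoord k l) (matCoord m n) (comulE r s) = 0 := by
  fin_cases r <;> fin_cases s <;> simp [comulE, matCoord_f]

theorem pairing_matCoord_comulMap (k l m n : Fin 2) (a : KP) :
    pairing (matCoord k l) (matCoord m n) (comulMap a)
      = ∑ i, a.1 i * pairing (matCoord k l) (matCoord m n) (comulF i) := by
  conv_lhs => rw [eq_sum a]
  simp only [map_add, map_sum, map_smul, comulMap_f, comulMap_E, pairing_matCoord_comulE,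
    smul_eq_mul, mul_zero, Finset.sum_const_zero, add_zero]

theorem pairing_comulMap_diag (a : KP) :
    pairing (matCoord 0 0) (matCoord 0 0) (comulMap a) = (a.1 0 + a.1 3) / 2 := by
  simp [pairing_matCoord_comulMap, Fin.sum_univ_four, comulF, matCoord_f, matCoord_E]
  ring

theorem pairing_comulMap_offDiag (a : KP) :
    pairing (matCoord 0 1) (matCoord 0 1) (comulMap a) = (a.1 0 - a.1 3) / 2 := by
  simp [pairing_matCoord_comulMap, Fin.sum_univ_four, comulF, matCoord_f, matCoord_E]
  ring

theorem pairing_comulMap_upper_lower (a : KP) :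
    pairing (matCoord 0 1) (matCoord 1 0) (comulMap a) = -(I / 2) * (a.1 1 - a.1 2) := by
  simp [pairing_matCoord_comulMap, Fin.sum_univ_four, comulF, matCoord_f, matCoord_E]
  ring

theorem pairing_comulMap_lower_upper (a : KP) :
    pairing (matCoord 1 0) (matCoord 0 1) (comulMap a) = (I / 2) * (a.1 1 - a.1 2) := by
  simp [pairing_matCoord_comulMap, Fin.sum_univ_four, comulF, matCoord_f, matCoord_E]
  ring

end Coproduct

section Entries

variable {V : Type*} [Fintype V] {u : Matrix V V KP}

theorem fst_swap (hu : IsMagicRep u) (i j : V) : (u j i).1 = (u i j).1 := by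
  rw [← hu.antipode isFaithfulPositive_haar i j]
  rfl

theorem snd_swap (hu : IsMagicRep u) (i j : V) : (u j i).2 = (u i j).2ᵀ := by
  rw [← hu.antipode isFaithfulPositive_haar i j]
  rfl

theorem fst_self_zero (hu : IsMagicRep u) (i : V) : (u i i).1 0 = 1 := by
  classical
  exact (hu.counit isFaithfulPositive_haar i i).trans (if_pos rfl)

theorem sum_fst (hu : IsMagicRep u) (i : V) : ∑ k, (u i k).1 = 1 :=
  (map_sum (AddMonoidHom.fst (Fin 4 → ℂ) (Matrix (Fin 2) (Fin 2) ℂ)) (u i) _).symm.trans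
    (congrArg Prod.fst (hu.magic.row i))

theorem sum_snd (hu : IsMagicRep u) (i : V) : ∑ k, (u i k).2 = 1 :=
  (map_sum (AddMonoidHom.snd (Fin 4 → ℂ) (Matrix (Fin 2) (Fin 2) ℂ)) (u i) _).symm.trans
    (congrArg Prod.snd (hu.magic.row i))

theorem sum_snd_mul_snd (hu : IsMagicRep u) (i : V) (k l m n : Fin 2) :
    ∑ j, (u i j).2 k l * (u i j).2 m n
      = pairing (matCoord k l) (matCoord n m) (comulMap (u i i)) := by
  rw [show comulMap (u i i) = _ from hu.comul i i, map_sum]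
  refine Finset.sum_congr rfl fun j _ => ?_
  rw [pairing_tmul]
  exact congrArg ((u i j).2 k l * ·) (congrFun₂ (snd_swap hu i j) n m).symm

end Entries

section MatrixPart

theorem p_zero_one_sq : p 0 1 * p 0 1 = -(I / 4) := by
  have h : Complex.exp (-(Real.pi / 4 * I)) * Complex.exp (-(Real.pi / 4 * I)) = -I := by
    rw [← Complex.exp_add, show -(Real.pi / 4 * I) + -(Real.pi / 4 * I) = -((Real.pi / 2 : ℂ) * I)
      by ring, Complex.exp_neg, Complex.exp_pi_div_two_mul_I, Complex.inv_I]
  simp only [p, Matrix.of_apply, Matrix.cons_val]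
  linear_combination h / 4

theorem p_one_zero_sq : p 1 0 * p 1 0 = I / 4 := by
  have h : Complex.exp (Real.pi / 4 * I) * Complex.exp (Real.pi / 4 * I) = I := by
    rw [← Complex.exp_add, show Real.pi / 4 * I + Real.pi / 4 * I = (Real.pi / 2 : ℂ) * I
      by ring, Complex.exp_pi_div_two_mul_I]
  simp only [p, Matrix.of_apply, Matrix.cons_val]
  linear_combination h / 4

theorem p_zero_one_mul_p_one_zero : p 0 1 * p 1 0 = 1 / 4 := by
  have h : Complex.exp (-(Real.pi / 4 * I)) * Complex.exp (Real.pi / 4 * I) = 1 := by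
    rw [← Complex.exp_add, neg_add_cancel, Complex.exp_zero]
  simp only [p, Matrix.of_apply, Matrix.cons_val]
  linear_combination h / 4

/-- The equations which the quadratic relations between the entries of a row with diagonal entry
`f 0 + f s` impose on `P`, if the matrix parts of the row are `P` and `1 - P`. -/
structure IsMatrixPart (s : Fin 4) (P : Matrix (Fin 2) (Fin 2) ℂ) : Prop where
  trace_eq : P.trace = 1
  diag : P 0 0 * P 0 0 + P 1 1 * P 1 1 = ((chi {0, s}).1 0 + (chi {0, s}).1 3) / 2
  upper_mul_lower : P 0 1 * P 1 0 = ((chi {0, s}).1 0 - (chi {0, s}).1 3) / 4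
  upper : P 0 1 * P 0 1 = -(I / 4) * ((chi {0, s}).1 1 - (chi {0, s}).1 2)
  lower : P 1 0 * P 1 0 = (I / 4) * ((chi {0, s}).1 1 - (chi {0, s}).1 2)

theorem isMatrixPart_p : IsMatrixPart 1 p where
  trace_eq := by norm_num [trace_fin_two, p]
  diag := by simp [p, chi_fst_apply]; norm_num
  upper_mul_lower := by simp [p_zero_one_mul_p_one_zero, chi_fst_apply]
  upper := by simp [p_zero_one_sq, chi_fst_apply]
  lower := by simp [p_one_zero_sq, chi_fst_apply]

theorem isMatrixPart_transpose_p : IsMatrixPart 2 pᵀ where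
  trace_eq := isMatrixPart_p.trace_eq
  diag := by simp [p, chi_fst_apply]; norm_num
  upper_mul_lower := by simp [mul_comm (p 1 0), p_zero_one_mul_p_one_zero, chi_fst_apply]
  upper := by simp [p_one_zero_sq, chi_fst_apply]
  lower := by simp [p_zero_one_sq, chi_fst_apply]

theorem isMatrixPart_single : IsMatrixPart 3 (Matrix.single 0 0 1) where
  trace_eq := by simp
  diag := by simp [chi_fst_apply]
  upper_mul_lower := by simp [chi_fst_apply]
  upper := by simp [chi_fst_apply]
  lower := by simp [chi_fst_apply]

theorem chi_one_sub_chi_two (s : Fin 4) : (chi {0, s}).1 1 - (chi {0, s}).1 2 =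
    ((if s = 1 then 1 else if s = 2 then -1 else 0 : ℤ) : ℂ) := by
  fin_cases s <;> simp [chi_fst_apply]

namespace IsMatrixPart

variable {s t : Fin 4} {P Q : Matrix (Fin 2) (Fin 2) ℂ}

theorem eq_or_eq_one_sub (hP : IsMatrixPart s P) (hQ : IsMatrixPart s Q)
    (hor : Q 0 0 = 1 / 2 ∨ Q 0 1 = 0 ∧ Q 1 0 = 0) : P = Q ∨ P = 1 - Q := by
  have lower_right {R : Matrix (Fin 2) (Fin 2) ℂ} (hR : IsMatrixPart s R) : R 1 1 = 1 - R 0 0 := by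
    rw [← hR.trace_eq, trace_fin_two, add_sub_cancel_left]
  have diag : P 0 0 = Q 0 0 ∨ P 0 0 = 1 - Q 0 0 := by
    have h := hP.diag.trans hQ.diag.symm
    rw [lower_right hP, lower_right hQ] at h
    rw [← sub_eq_zero, ← sub_eq_zero (b := 1 - _), ← mul_eq_zero]
    linear_combination h / 2
  have off_diag : P 0 1 = Q 0 1 ∧ P 1 0 = Q 1 0 ∨ P 0 1 = -Q 0 1 ∧ P 1 0 = -Q 1 0 := by
    have hmul := hP.upper_mul_lower.trans hQ.upper_mul_lower.symm
    have hupper := hP.upper.trans hQ.upper.symm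
    have hlower := hP.lower.trans hQ.lower.symm
    grind
  simp only [← Matrix.ext_iff, Fin.forall_fin_two, Matrix.sub_apply, one_apply_eq, ne_eq,
    zero_ne_one, one_ne_zero, not_false_eq_true, one_apply_ne, zero_sub, lower_right hP,
    lower_right hQ]
  grind

theorem eq_or_eq_one_sub_p (hP : IsMatrixPart 1 P) : P = p ∨ P = 1 - p :=
  hP.eq_or_eq_one_sub isMatrixPart_p (.inl rfl)

theorem eq_or_eq_one_sub_transpose_p (hP : IsMatrixPart 2 P) : P = pᵀ ∨ P = 1 - pᵀ :=
  hP.eq_or_eq_one_sub isMatrixPart_transpose_p (.inl rfl)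

theorem eq_or_eq_one_sub_single (hP : IsMatrixPart 3 P) :
    P = single 0 0 1 ∨ P = 1 - single 0 0 1 :=
  hP.eq_or_eq_one_sub isMatrixPart_single (.inr (by simp))

theorem eq_swap_of_transpose (hP : IsMatrixPart s P) (hPt : IsMatrixPart t Pᵀ) (hs : s ≠ 0)
    (ht : t ≠ 0) : t = Equiv.swap 1 2 s := by
  have h := hP.upper.symm.trans hPt.lower
  rw [chi_one_sub_chi_two, chi_one_sub_chi_two, neg_mul_comm] at h
  replace h := mul_left_cancel₀ (show (I / 4 : ℂ) ≠ 0 by simp) h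
  norm_cast at h
  clear hP hPt
  revert s t
  decide

theorem eq_three_of_transpose_eq (hP : IsMatrixPart s P) (hs : s ≠ 0) (hsymm : Pᵀ = P) :
    s = 3 := by
  have h := hP.eq_swap_of_transpose (hsymm.symm ▸ hP) hs hs
  clear hP
  revert s
  decide

end IsMatrixPart

theorem isMatrixPart_snd {V : Type*} [Fintype V] {u : Matrix V V KP} (hu : IsMagicRep u)
    {i j k : V} {s : Fin 4} (hjk : j ≠ k) (hrest : ∀ l, l ≠ j → l ≠ k → (u i l).2 = 0)
    (htrace : (u i j).2.trace = 1) (hs : (u i i).1 = (chi {0, s}).1) :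
    IsMatrixPart s (u i j).2 := by
  have sum_eq_add {M : Type _} [AddCommMonoid M] (F : Matrix (Fin 2) (Fin 2) ℂ → M)
      (hF : F 0 = 0) : ∑ l, F (u i l).2 = F (u i j).2 + F (u i k).2 := by
    classical
    exact Fintype.sum_eq_add j k hjk fun l hl => by rw [hrest l hl.1 hl.2, hF]
  have complement : (u i k).2 = 1 - (u i j).2 :=
    eq_sub_of_add_eq' ((sum_eq_add id rfl).symm.trans (sum_snd hu i))
  have relation (k l m n : Fin 2) :=
    (sum_eq_add (fun P => P k l * P m n) (zero_mul _)).symm.trans (sum_snd_mul_snd hu i k l m n)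
  have lower_right : (u i j).2 1 1 = 1 - (u i j).2 0 0 := by
    rw [← htrace, trace_fin_two, add_sub_cancel_left]
  have hdiag := relation 0 0 0 0
  have hmul := relation 0 1 1 0
  have hupper := relation 0 1 0 1
  have hlower := relation 1 0 1 0
  rw [pairing_comulMap_diag] at hdiag
  rw [pairing_comulMap_offDiag] at hmul
  rw [pairing_comulMap_upper_lower] at hupper
  rw [pairing_comulMap_lower_upper] at hlower
  simp only [hs, complement, Matrix.sub_apply, one_apply_eq, ne_eq, zero_ne_one, one_ne_zero,
    not_false_eq_true, one_apply_ne] at hdiag hmul hupper hlower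
  exact ⟨htrace, by rw [lower_right]; linear_combination hdiag, by linear_combination hmul / 2,
    by linear_combination hupper / 2, by linear_combination hlower / 2⟩

end MatrixPart

/-! ### Classification of the magic representations of `G₀` -/

/-- The permutation `(13)(24)`, as an element of `D₄`. -/
def cross : D4 := ⟨Equiv.swap 0 2 * Equiv.swap 1 3, by change _ ∈ d4List; decide⟩

section CardTwo

theorem one_sub_chi_add_ofMat (S : Finset (Fin 4)) (P : Matrix (Fin 2) (Fin 2) ℂ) :
    1 - (chi S + ofMat P) = chi Sᶜ + ofMat (1 - P) := by
  refine Prod.ext ?_ ?_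
  · change 1 - ((chi S).1 + 0) = (chi Sᶜ).1 + 0
    rw [chi_compl_fst, add_zero, add_zero]
  · change 1 - ((chi S).2 + P) = (chi Sᶜ).2 + (1 - P)
    rw [chi_snd, chi_snd, zero_add, zero_add]

theorem eq_chi_add_ofMat {a : KP} {S : Finset (Fin 4)} (ha : a.1 = (chi S).1) :
    a = chi S + ofMat a.2 :=
  Prod.ext (ha.trans (add_zero _).symm) (by rw [KP.snd_add, chi_snd, zero_add]; rfl)

theorem one_sub_single_zero : (1 : Matrix (Fin 2) (Fin 2) ℂ) - single 0 0 1 = single 1 1 1 := by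
  ext i j
  fin_cases i <;> fin_cases j <;> simp

theorem one_sub_single_one : (1 : Matrix (Fin 2) (Fin 2) ℂ) - single 1 1 1 = single 0 0 1 := by
  rw [← one_sub_single_zero, sub_sub_cancel]

theorem chi_zero_three : chi {0, 3} = f 0 + f 3 := chi_pair (by decide)

theorem chi_compl_zero_three : chi {0, 3}ᶜ = f 1 + f 2 := chi_pair (i := 1) (j := 2) (by decide)

/-- The common form of the magic matrices of size two: `x`, `y`, `z` are of this form. -/
def blockTwo {A : Type*} [Ring A] (q : A) : Matrix (Fin 2) (Fin 2) A := !![q, 1 - q; 1 - q, q]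

theorem repX_eq_blockTwo : repX = blockTwo (chi Finset.univ + ofMat 0) := by
  have chi_univ : chi Finset.univ = f 0 + f 1 + f 2 + f 3 := Fin.sum_univ_four f
  have chi_empty : chi Finset.univᶜ = 0 := by rw [Finset.compl_univ]; rfl
  have ofMat_zero : ofMat 0 = 0 := rfl
  rw [blockTwo, one_sub_chi_add_ofMat, chi_empty, chi_univ, ofMat_zero, sub_zero, zero_add,
    add_zero, repX]

theorem repY_eq_blockTwo : repY = blockTwo (chi {0, 3} + ofMat (single 0 0 1)) := by
  rw [blockTwo, one_sub_chi_add_ofMat, chi_zero_three, chi_compl_zero_three, one_sub_single_zero]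
  rfl

theorem repZ_eq_blockTwo : repZ = blockTwo (chi {0, 3} + ofMat (single 1 1 1)) := by
  rw [blockTwo, one_sub_chi_add_ofMat, chi_zero_three, chi_compl_zero_three, one_sub_single_one]
  rfl

theorem eq_blockTwo {A : Type*} [Ring A] [StarRing A] {u : Matrix (Fin 2) (Fin 2) A}
    (hu : IsMagic u) : u = blockTwo (u 0 0) := by
  have row (i : Fin 2) := hu.row i
  have col := hu.col 0
  simp only [Fin.sum_univ_two] at row col
  have h01 : u 0 1 = 1 - u 0 0 := eq_sub_of_add_eq' (row 0)
  have h10 : u 1 0 = 1 - u 0 0 := eq_sub_of_add_eq' col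
  have h11 : u 1 1 = u 0 0 := by rw [eq_sub_of_add_eq' (row 1), h10, sub_sub_cancel]
  ext i j
  fin_cases i <;> fin_cases j <;> simp [blockTwo, h01, h10, h11]

theorem exists_rep_eq_of_fin_two {u : Matrix (Fin 2) (Fin 2) KP} (hu : IsMagicRep u)
    (h8 : 8 * haar (u 0 0) = 4) : u = repX ∨ u = repY ∨ u = repZ := by
  have self_zero := fst_self_zero hu 0
  rw [eq_blockTwo hu.magic]
  rcases fst_eq_one_or_trace_eq_one_of_eight_mul_haar_eq_four (hu.magic.proj 0 0) self_zero
    h8 with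
    ⟨fst_eq, snd_eq⟩ | ⟨hsum, htrace⟩
  · left
    have : (u 0 0).1 = (chi Finset.univ).1 := fst_eq.trans (funext fun i => by simp [chi_fst_apply])
    rw [eq_chi_add_ofMat this, snd_eq, repX_eq_blockTwo]
  · right
    obtain ⟨s, hs, fst_eq⟩ := exists_fst_eq_chi_pair (hu.magic.proj 0 0) self_zero hsum
    have hP : IsMatrixPart s (u 0 0).2 := isMatrixPart_snd hu (zero_ne_one' (Fin 2))
      (fun l h₀ h₁ => by lia) htrace fst_eq
    obtain rfl := hP.eq_three_of_transpose_eq hs (snd_swap hu 0 0).symm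
    rw [eq_chi_add_ofMat fst_eq, repY_eq_blockTwo, repZ_eq_blockTwo]
    refine hP.eq_or_eq_one_sub_single.imp (fun h => by rw [h]) fun h => ?_
    rw [h, one_sub_single_zero]

end CardTwo

section CardFour

/-- The form of a transitive magic matrix of size four in which the entries with indices in the
same one of the pairs `{0, 1}` and `{2, 3}` are central, and the others are of rank one. -/
def blockFour (s t : Fin 4) (P : Matrix (Fin 2) (Fin 2) ℂ) : Matrix (Fin 4) (Fin 4) KP :=
  !![chi {0, s}, chi {0, s}ᶜ, ofMat P, ofMat (1 - P);
    chi {0, s}ᶜ, chi {0, s}, ofMat (1 - P), ofMat P;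
    ofMat Pᵀ, ofMat (1 - Pᵀ), chi {0, t}, chi {0, t}ᶜ;
    ofMat (1 - Pᵀ), ofMat Pᵀ, chi {0, t}ᶜ, chi {0, t}]

theorem blockFour_submatrix_swap (s t : Fin 4) (P : Matrix (Fin 2) (Fin 2) ℂ) :
    (blockFour s t P).submatrix (Equiv.swap 2 3) (Equiv.swap 2 3) = blockFour s t (1 - P) := by
  ext1 i j
  fin_cases i <;> fin_cases j <;> simp [blockFour, Equiv.swap_apply_def]

theorem repU_eq_blockFour : repU = blockFour 1 2 p := by
  have chi_compl_zero_one : chi {0, 1}ᶜ = f 2 + f 3 := chi_pair (i := 2) (j := 3) (by decide)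
  have chi_compl_zero_two : chi {0, 2}ᶜ = f 1 + f 3 := chi_pair (i := 1) (j := 3) (by decide)
  rw [blockFour, chi_compl_zero_one, chi_compl_zero_two, chi_pair (by decide),
    chi_pair (by decide), repU]

theorem blockFour_submatrix_cross (s t : Fin 4) (P : Matrix (Fin 2) (Fin 2) ℂ) :
    (blockFour s t P).submatrix (cross : Equiv.Perm (Fin 4)) (cross : Equiv.Perm (Fin 4))
      = blockFour t s Pᵀ := by
  have cross_eq : ((cross : Equiv.Perm (Fin 4)) : Fin 4 → Fin 4) = ![2, 3, 0, 1] := by decide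
  rw [cross_eq]
  ext1 i j
  fin_cases i <;> fin_cases j <;> simp [blockFour]

theorem repW_eq_blockFour : repW = blockFour 3 3 (single 0 0 1) := by
  rw [blockFour, chi_compl_zero_three, chi_zero_three, one_sub_single_zero, transpose_single,
    one_sub_single_zero]
  rfl

theorem exists_partner {V : Type*} [Fintype V] {u : Matrix V V KP} (hu : IsMagicRep u)
    (hV : Fintype.card V = 4) (h8 : ∀ i j, 8 * haar (u i j) = 2) (i : V) :
    (u i i).2 = 0 ∧ ∃ m ≠ i, (u i m).2 = 0 ∧
      ∀ k, k ≠ i → k ≠ m → (u i k).1 = 0 ∧ (u i k).2.trace = 1 := by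
  classical
  have dichotomy (k : V) :=
    snd_eq_zero_or_trace_eq_one_of_eight_mul_haar_eq_two (hu.magic.proj i k) (h8 i k)
  have self_eq_zero : (u i i).2 = 0 := (dichotomy i).resolve_right fun h => by
    have := fst_self_zero hu i
    simp [h.1] at this
  let Z : Finset V := {k | (u i k).2 = 0}
  have card_compl : Zᶜ.card = 2 := by
    have trace_eq (k : V) : (u i k).2.trace = if k ∈ Zᶜ then 1 else 0 := by
      by_cases hk : (u i k).2 = 0
      · simp [Z, hk]
      · simp [Z, hk, ((dichotomy k).resolve_left hk).2]
    have := congrArg trace (sum_snd hu i)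
    simp only [trace_sum, trace_eq, Finset.sum_boole, Finset.filter_univ_mem, trace_one,
      Fintype.card_fin] at this
    exact_mod_cast this
  have card_erase : (Z.erase i).card = 1 := by
    rw [Finset.card_compl] at card_compl
    rw [Finset.card_erase_of_mem (by simpa [Z] using self_eq_zero)]
    lia
  obtain ⟨m, hm⟩ := Finset.card_eq_one.mp card_erase
  have mem_iff (k : V) : k ≠ i ∧ (u i k).2 = 0 ↔ k = m := by
    rw [← Finset.mem_singleton (a := m), ← hm, Finset.mem_erase, Finset.mem_filter_univ]
  obtain ⟨hmi, snd_eq_zero⟩ := (mem_iff m).mpr rfl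
  exact ⟨self_eq_zero, m, hmi, snd_eq_zero, fun k hki hkm =>
    (dichotomy k).resolve_left fun hk => hkm ((mem_iff k).mp ⟨hki, hk⟩)⟩

theorem exists_equiv_fin_four {V : Type*} [Fintype V] (hV : Fintype.card V = 4) {m : V → V}
    (hm : Function.Involutive m) (hne : ∀ i, m i ≠ i) :
    ∃ e : Fin 4 ≃ V, m (e 0) = e 1 ∧ m (e 2) = e 3 := by
  classical
  obtain ⟨i⟩ : Nonempty V := Fintype.card_pos_iff.mp (by lia)
  obtain ⟨j, hj⟩ : ∃ j, j ∉ ({i, m i} : Finset V) := by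
    by_contra! h
    have : Fintype.card V ≤ 2 := (Finset.card_le_card fun v _ => h v).trans Finset.card_le_two
    lia
  have injective : Function.Injective ![i, m i, j, m j] := by
    have := hne i
    have := hne j
    have := hm i
    have := hm j
    intro a b
    fin_cases a <;> fin_cases b <;> simp <;> grind
  have bijective := (Fintype.bijective_iff_injective_and_card _).mpr ⟨injective, by simp [hV]⟩
  exact ⟨Equiv.ofBijective _ bijective, rfl, rfl⟩

/-- The shape of the transitive magic representations of size four: the entries with indices in the
same one of the pairs `{0, 1}` and `{2, 3}` are central, and the others are rank one projections in
the summand `M₂(ℂ)`. -/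
structure IsPaired (u : Matrix (Fin 4) (Fin 4) KP) : Prop where
  snd_eq_zero : ∀ i j, i.val / 2 = j.val / 2 → (u i j).2 = 0
  fst_eq_zero : ∀ i j, i.val / 2 ≠ j.val / 2 → (u i j).1 = 0
  trace_eq_one : ∀ i j, i.val / 2 ≠ j.val / 2 → (u i j).2.trace = 1

theorem exists_isPaired {V : Type*} [Fintype V] {u : Matrix V V KP} (hu : IsMagicRep u)
    (hV : Fintype.card V = 4) (h8 : ∀ i j, 8 * haar (u i j) = 2) :
    ∃ e : Fin 4 ≃ V, IsPaired (u.submatrix e e) := by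
  choose self_eq_zero m hmi snd_eq_zero rest using exists_partner hu hV h8
  have involutive : Function.Involutive m := fun i => by
    by_contra hne
    have := (rest (m i) i (hmi i).symm (Ne.symm hne)).2
    rw [snd_swap hu, snd_eq_zero] at this
    simp at this
  obtain ⟨e, h01, h23⟩ := exists_equiv_fin_four hV involutive hmi
  have h10 : m (e 1) = e 0 := by rw [← h01, involutive]
  have h32 : m (e 3) = e 2 := by rw [← h23, involutive]
  have same_pair (i j : Fin 4) : i.val / 2 = j.val / 2 ↔ e j = e i ∨ e j = m (e i) := by
    fin_cases i <;> fin_cases j <;> simp [h01, h10, h23, h32]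
  have other_pair {i j : Fin 4} (hij : i.val / 2 ≠ j.val / 2) := by
    obtain ⟨h₁, h₂⟩ := not_or.mp ((same_pair i j).not.mp hij)
    exact rest (e i) (e j) h₁ h₂
  refine ⟨e, fun i j hij => ?_, fun i j hij => (other_pair hij).1, fun i j hij =>
    (other_pair hij).2⟩
  change (u (e i) (e j)).2 = 0
  rcases (same_pair i j).mp hij with h | h <;> rw [h]
  · exact self_eq_zero _
  · exact snd_eq_zero _

end CardFour

section Shape

theorem IsPaired.fst_add_fst {u : Matrix (Fin 4) (Fin 4) KP} (h : IsPaired u) (hu : IsMagicRep u)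
    {i j : Fin 4} (hne : i ≠ j) (hij : i.val / 2 = j.val / 2) : (u i i).1 + (u i j).1 = 1 := by
  rw [← sum_fst hu i, Fintype.sum_eq_add i j hne fun k hk => h.fst_eq_zero i k (by lia)]

theorem IsPaired.snd_add_snd {u : Matrix (Fin 4) (Fin 4) KP} (h : IsPaired u) (hu : IsMagicRep u)
    {i j k : Fin 4} (hne : j ≠ k) (hij : i.val / 2 ≠ j.val / 2) (hik : i.val / 2 ≠ k.val / 2) :
    (u i j).2 + (u i k).2 = 1 := by
  rw [← sum_snd hu i, Fintype.sum_eq_add j k hne fun l hl => h.snd_eq_zero i l (by lia)]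

theorem IsPaired.eq_blockFour {u : Matrix (Fin 4) (Fin 4) KP} (h : IsPaired u) (hu : IsMagicRep u)
    {s t : Fin 4} (hs : (u 0 0).1 = (chi {0, s}).1) (ht : (u 2 2).1 = (chi {0, t}).1) :
    u = blockFour s t (u 0 2).2 := by
  have fst_pair {i j : Fin 4} {S : Finset (Fin 4)} (hne : i ≠ j) (hij : i.val / 2 = j.val / 2)
      (hS : (u i i).1 = (chi S).1) : (u i j).1 = (chi Sᶜ).1 ∧ (u j j).1 = (chi S).1 := by
    have fst_compl : (u i j).1 = 1 - (u i i).1 := eq_sub_of_add_eq' (h.fst_add_fst hu hne hij)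
    refine ⟨by rw [fst_compl, hS, chi_compl_fst], ?_⟩
    rw [eq_sub_of_add_eq (h.fst_add_fst hu hne.symm hij.symm), fst_swap hu i j, fst_compl,
      sub_sub_cancel, hS]
  obtain ⟨h01, h11⟩ := fst_pair zero_ne_one rfl hs
  obtain ⟨h23, h33⟩ := fst_pair (i := 2) (j := 3) (by decide) rfl ht
  have h03 : (u 0 3).2 = 1 - (u 0 2).2 :=
    eq_sub_of_add_eq' (h.snd_add_snd hu (by decide) (by decide) (by decide))
  have h21 : (u 2 1).2 = 1 - (u 2 0).2 :=
    eq_sub_of_add_eq' (h.snd_add_snd hu (by decide) (by decide) (by decide))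
  rw [snd_swap hu 0 2] at h21
  have h12 : (u 1 2).2 = 1 - (u 0 2).2 := by
    rw [snd_swap hu 2 1, h21, transpose_sub, transpose_one, transpose_transpose]
  have h13 : (u 1 3).2 = (u 0 2).2 := by
    have : (u 1 3).2 = 1 - (u 1 2).2 :=
      eq_sub_of_add_eq' (h.snd_add_snd hu (by decide) (by decide) (by decide))
    rw [this, h12, sub_sub_cancel]
  ext1 i j
  refine Prod.ext ?_ ?_ <;> fin_cases i <;> fin_cases j <;>
    simp [blockFour, ofMat, chi_snd, h.fst_eq_zero, h.snd_eq_zero, hs, ht, h01, h11, h23, h33,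
      h03, h12, h13, fst_swap hu 0 1, fst_swap hu 2 3, snd_swap hu 0 2, snd_swap hu 0 3, h21,
      snd_swap hu 1 3]

theorem exists_blockFour_submatrix {s t : Fin 4} {P Q : Matrix (Fin 2) (Fin 2) ℂ}
    (hPQ : P = Q ∨ P = 1 - Q) :
    ∃ σ : Equiv.Perm (Fin 4), (blockFour s t P).submatrix σ σ = blockFour s t Q := by
  rcases hPQ with rfl | rfl
  · exact ⟨1, rfl⟩
  · exact ⟨Equiv.swap 2 3, by rw [blockFour_submatrix_swap, sub_sub_cancel]⟩

theorem exists_blockFour_submatrix_eq_rep {s : Fin 4} (hs : s ≠ 0)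
    {P : Matrix (Fin 2) (Fin 2) ℂ} (hP : IsMatrixPart s P) :
    ∃ σ : Equiv.Perm (Fin 4), (blockFour s (Equiv.swap 1 2 s) P).submatrix σ σ = repU ∨
      (blockFour s (Equiv.swap 1 2 s) P).submatrix σ σ = repW := by
  obtain rfl | rfl | rfl : s = 1 ∨ s = 2 ∨ s = 3 := by lia
  · rw [Equiv.swap_apply_left, repU_eq_blockFour]
    obtain ⟨σ, hσ⟩ := exists_blockFour_submatrix (s := 1) (t := 2) hP.eq_or_eq_one_sub_p
    exact ⟨σ, .inl hσ⟩
  · rw [Equiv.swap_apply_right, repU_eq_blockFour]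
    obtain ⟨σ, hσ⟩ := exists_blockFour_submatrix (s := 2) (t := 1) hP.eq_or_eq_one_sub_transpose_p
    refine ⟨(cross : Equiv.Perm (Fin 4)).trans σ, .inl ?_⟩
    rw [Equiv.coe_trans, ← submatrix_submatrix, hσ, blockFour_submatrix_cross, transpose_transpose]
  · rw [Equiv.swap_apply_of_ne_of_ne (by decide) (by decide), repW_eq_blockFour]
    obtain ⟨σ, hσ⟩ := exists_blockFour_submatrix (s := 3) (t := 3) hP.eq_or_eq_one_sub_single
    exact ⟨σ, .inr hσ⟩

theorem IsPaired.exists_submatrix_eq_rep {u : Matrix (Fin 4) (Fin 4) KP} (h : IsPaired u)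
    (hu : IsMagicRep u) (h8 : ∀ i, 8 * haar (u i i) = 2) :
    ∃ σ : Equiv.Perm (Fin 4), u.submatrix σ σ = repU ∨ u.submatrix σ σ = repW := by
  have sum_eq_two (i : Fin 4) : ∑ k, (u i i).1 k = 2 := by
    rw [← h8 i, eight_mul_haar, h.snd_eq_zero i i rfl, trace_zero, mul_zero, add_zero]
  have exists_pair (i : Fin 4) :=
    exists_fst_eq_chi_pair (hu.magic.proj i i) (fst_self_zero hu i) (sum_eq_two i)
  obtain ⟨s, hs, fst_s⟩ := exists_pair 0
  obtain ⟨t, ht, fst_t⟩ := exists_pair 2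
  have isMatrixPart_s : IsMatrixPart s (u 0 2).2 :=
    isMatrixPart_snd hu (k := 3) (by decide)
      (fun l h₂ h₃ => h.snd_eq_zero 0 l (by revert l; decide))
      (h.trace_eq_one 0 2 (by decide)) fst_s
  have isMatrixPart_t : IsMatrixPart t (u 0 2).2ᵀ := by
    rw [← snd_swap hu 0 2]
    exact isMatrixPart_snd hu (k := 1) (by decide)
      (fun l h₀ h₁ => h.snd_eq_zero 2 l (by revert l; decide))
      (h.trace_eq_one 2 0 (by decide)) fst_t
  rw [h.eq_blockFour hu fst_s fst_t, isMatrixPart_s.eq_swap_of_transpose isMatrixPart_t hs ht]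
  exact exists_blockFour_submatrix_eq_rep hs isMatrixPart_s

end Shape

section Classification

variable {V : Type*} [Fintype V] {u : Matrix V V KP}

theorem exists_card_mul_eq_eight [Nonempty V] (hu : IsMagicRep u) (hne : ∀ i j, u i j ≠ 0) :
    ∃ m : ℕ, Fintype.card V * m = 8 ∧ ∀ i j, 8 * haar (u i j) = m := by
  obtain ⟨i₀⟩ := ‹Nonempty V›
  obtain ⟨S, r, -, haar_eq, -⟩ := exists_support_rank (hu.magic.proj i₀ i₀)
  have card_mul_haar (i j : V) : Fintype.card V * (8 * haar (u i j)) = 8 := by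
    linear_combination 8 * hu.card_mul_haar isHaarTrace_haar hne i j
  have card_ne_zero : (Fintype.card V : ℂ) ≠ 0 := left_ne_zero_of_mul
    ((card_mul_haar i₀ i₀).trans_ne (by norm_num))
  refine ⟨S.card + 2 * r, ?_, fun i j => mul_left_cancel₀ card_ne_zero ?_⟩
  · exact_mod_cast haar_eq ▸ card_mul_haar i₀ i₀
  · rw [← haar_eq, card_mul_haar, card_mul_haar]

theorem not_forall_eight_mul_haar_eq_one [Nonempty V] (hu : IsMagicRep u) :
    ¬ ∀ i j, 8 * haar (u i j) = 1 := by
  intro h8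
  obtain ⟨i₀⟩ := ‹Nonempty V›
  refine zero_ne_one' (Matrix (Fin 2) (Fin 2) ℂ) ?_
  rw [← sum_snd hu i₀]
  exact (Finset.sum_eq_zero fun j _ =>
    snd_eq_zero_of_eight_mul_haar_eq_one (hu.magic.proj i₀ j) (h8 i₀ j)).symm

theorem exists_blockType_of_transitive [Nonempty V] (hu : IsMagicRep u) (hne : ∀ i j, u i j ≠ 0) :
    ∃ (t : BlockType) (e : Fin t.size ≃ V), u.submatrix e e = t.rep := by
  obtain ⟨m, card_mul, h8⟩ := exists_card_mul_eq_eight hu hne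
  have m_dvd : m ∈ Nat.divisors 8 := by simpa using Dvd.intro_left _ card_mul
  obtain rfl | rfl | rfl | rfl : m = 1 ∨ m = 2 ∨ m = 4 ∨ m = 8 := by
    simpa [show Nat.divisors 8 = {1, 2, 4, 8} by decide] using m_dvd
  · exact absurd (by exact_mod_cast h8) (not_forall_eight_mul_haar_eq_one hu)
  · obtain ⟨e, he⟩ := exists_isPaired hu (by lia) (by exact_mod_cast h8)
    obtain ⟨σ, hσ | hσ⟩ := he.exists_submatrix_eq_rep (hu.submatrix_equiv e)
      fun i => by exact_mod_cast h8 (e i) (e i)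
    · exact ⟨.u, σ.trans e, hσ⟩
    · exact ⟨.w, σ.trans e, hσ⟩
  · let e : Fin 2 ≃ V := (Fintype.equivFinOfCardEq (by lia)).symm
    rcases exists_rep_eq_of_fin_two (hu.submatrix_equiv e) (by exact_mod_cast h8 (e 0) (e 0)) with
      h | h | h
    · exact ⟨.x, e, h⟩
    · exact ⟨.y, e, h⟩
    · exact ⟨.z, e, h⟩
  · let e : Fin 1 ≃ V := (Fintype.equivFinOfCardEq (by lia)).symm
    have sum_eq_one := (hu.submatrix_equiv e).magic.row 0
    rw [Fin.sum_univ_one] at sum_eq_one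
    have submatrix_eq_one : u.submatrix e e = 1 := by
      ext1 i j
      rwa [Subsingleton.elim i 0, Subsingleton.elim j 0]
    exact ⟨.one, e, submatrix_eq_one⟩

theorem exists_blockType_of_orbit (hu : IsMagicRep u) {ι : Type*} {c : V → ι}
    (hc : ∀ i j, c i = c j ↔ u i j ≠ 0) {q : ι} (hq : q ∈ Set.range c) :
    ∃ (t : BlockType) (e : Fin t.size ≃ {v // c v = q}),
      u.submatrix (fun x => (e x : V)) (fun x => (e x : V)) = t.rep := by
  classical
  obtain ⟨v, hv⟩ := hq
  have : Nonempty {v // c v = q} := ⟨⟨v, hv⟩⟩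
  have eq_zero {i j : V} (hi : c i = q) (hj : c j ≠ q) : u i j = 0 ∧ u j i = 0 :=
    ⟨not_not.mp (mt (hc i j).mpr (hi.trans_ne hj.symm)),
      not_not.mp (mt (hc j i).mpr (hj.trans_eq hi.symm))⟩
  have orbit := hu.submatrix (Subtype.val_injective (p := fun v => c v = q))
    (fun a i hi => (eq_zero a.2 (by simpa using hi)).1)
    (fun a i hi => (eq_zero a.2 (by simpa using hi)).2)
  exact exists_blockType_of_transitive orbit fun a b => (hc a b).mp (a.2.trans b.2.symm)

theorem nonempty_blockLabelling (hu : IsMagicRep u) : Nonempty (BlockLabelling u) := by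
  classical
  let orbits : Setoid V := hu.orbitSetoid isHaarTrace_haar
  let enum := Fintype.equivFin (Quotient orbits)
  let c : V → Fin (Fintype.card (Quotient orbits)) := fun v => enum (Quotient.mk orbits v)
  have hc (i j : V) : c i = c j ↔ u i j ≠ 0 := enum.injective.eq_iff.trans Quotient.eq
  have c_surjective : Function.Surjective c := enum.surjective.comp Quotient.mk_surjective
  choose t e he using fun q => exists_blockType_of_orbit hu hc (c_surjective q)
  let label : V ≃ (q : Fin (Fintype.card (Quotient orbits))) × Fin (t q).size :=
    (Equiv.sigmaFiberEquiv c).symm.trans (Equiv.sigmaCongrRight fun q => (e q).symm)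
  have label_apply (q) (v : {v // c v = q}) : label v = ⟨q, (e q).symm v⟩ := by
    obtain ⟨v, rfl⟩ := v
    rfl
  refine ⟨⟨_, t, label, Matrix.ext fun i j => ?_⟩⟩
  rw [Matrix.submatrix_apply]
  by_cases hij : c i = c j
  · rw [label_apply (c j) ⟨i, hij⟩, label_apply (c j) ⟨j, rfl⟩, blockDiagonal'_apply_eq, ← he]
    simp only [submatrix_apply, Equiv.apply_symm_apply]
  · exact (not_not.mp (mt (hc i j).mpr hij)).trans (blockDiagonal'_apply_ne _ _ _ hij).symm

end Classification

/-! ### The orbital preserving action of `D₄` -/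

section DihedralGroup

/-- The bijection from the dihedral group of order `8` to `D₄` which sends the rotation `r 1` to
`(1324)` and the reflection `sr 0` to `(12)`. -/
def dihedralToD4 : DihedralGroup 4 → D4
  | .r i => ⟨c[0, 2, 1, 3] ^ i.val, D4.pow_mem (by change _ ∈ d4List; decide) _⟩
  | .sr i => ⟨Equiv.swap 0 1 * c[0, 2, 1, 3] ^ i.val,
      D4.mul_mem (by change _ ∈ d4List; decide) (D4.pow_mem (by change _ ∈ d4List; decide) _)⟩

theorem dihedralToD4_mul : ∀ a b, dihedralToD4 (a * b) = dihedralToD4 a * dihedralToD4 b := by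
  decide

theorem dihedralToD4_bijective : Function.Bijective dihedralToD4 := by
  refine ⟨by unfold Function.Injective; decide, fun ⟨ω, hω⟩ => ?_⟩
  have exists_eq : ∀ ω ∈ d4List, ∃ g, (dihedralToD4 g).1 = ω := by decide
  exact (exists_eq ω hω).imp fun _ hg => Subtype.ext hg

theorem nonempty_d4_mulEquiv_dihedralGroup : Nonempty (D4 ≃* DihedralGroup 4) :=
  ⟨(MulEquiv.ofBijective (MonoidHom.mk' _ dihedralToD4_mul) dihedralToD4_bijective).symm⟩

theorem natCard_d4 : Nat.card D4 = 8 := by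
  rw [← Nat.card_congr (.ofBijective _ dihedralToD4_bijective), DihedralGroup.nat_card]

/-- The permutation `(12)`, as an element of `D₄`. -/
def flip : D4 := ⟨Equiv.swap 0 1, by change _ ∈ d4List; decide⟩

theorem closure_flip_cross : Submonoid.closure {flip, cross} = ⊤ := by
  have word : ∀ ω ∈ d4List, ∃ a b c d : Fin 2, (flip.1 ^ a.1 * cross.1 ^ b.1) *
      (flip.1 ^ c.1 * cross.1 ^ d.1) = ω := by decide
  have flip_mem : flip ∈ Submonoid.closure {flip, cross} :=
    Submonoid.subset_closure (Set.mem_insert _ _)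
  have cross_mem : cross ∈ Submonoid.closure {flip, cross} :=
    Submonoid.subset_closure (Set.mem_insert_of_mem _ rfl)
  refine eq_top_iff.mpr fun ω _ => ?_
  obtain ⟨a, b, c, d, h⟩ := word ω.1 ω.2
  rw [← Subtype.ext (a1 := (flip ^ a.1 * cross ^ b.1) * (flip ^ c.1 * cross ^ d.1)) h]
  exact mul_mem (mul_mem (pow_mem flip_mem _) (pow_mem cross_mem _))
    (mul_mem (pow_mem flip_mem _) (pow_mem cross_mem _))

end DihedralGroup

section Coordinates

/-- The element of `C(G₀)` with coordinates `a` in the basis `½(f₁ + f₂ + f₃ + f₄)`,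
`½(f₁ + f₂ - f₃ - f₄)`, `½(f₁ - f₂ + f₃ - f₄)`, `½(f₁ - f₂ - f₃ + f₄)`, `½I₂`, `p - ½I₂`,
`pᵀ - ½I₂`, `½(E₁₁ - E₂₂)`, which is orthonormal for the bilinear form `8 h(ab)`, where `h` is the
Haar functional. All entries of the transitive magic representations have integer coordinates. -/
def ofCoords (a : Fin 8 → ℤ) : KP :=
  (![(a 0 + a 1 + a 2 + a 3) / 2, (a 0 + a 1 - a 2 - a 3) / 2, (a 0 - a 1 + a 2 - a 3) / 2,
      (a 0 - a 1 - a 2 + a 3) / 2],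
    !![(a 4 + a 7) / 2, a 5 * p 0 1 + a 6 * p 1 0; a 5 * p 1 0 + a 6 * p 0 1, (a 4 - a 7) / 2])

theorem ofCoords_fst (a : Fin 8 → ℤ) : (ofCoords a).1 =
    (![(a 0 + a 1 + a 2 + a 3) / 2, (a 0 + a 1 - a 2 - a 3) / 2, (a 0 - a 1 + a 2 - a 3) / 2,
      (a 0 - a 1 - a 2 + a 3) / 2] : Fin 4 → ℂ) := rfl

theorem ofCoords_snd (a : Fin 8 → ℤ) : (ofCoords a).2 =
    (!![(a 4 + a 7) / 2, a 5 * p 0 1 + a 6 * p 1 0;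
      a 5 * p 1 0 + a 6 * p 0 1, (a 4 - a 7) / 2] : Matrix (Fin 2) (Fin 2) ℂ) := rfl

theorem eight_mul_haar_ofCoords_mul_ofCoords (a b : Fin 8 → ℤ) :
    8 * haar (ofCoords a * ofCoords b) = (a ⬝ᵥ b : ℤ) := by
  simp only [haar_apply, trace, diag_apply, KP.fst_mul, KP.snd_mul, Pi.mul_apply, mul_apply,
    Fin.sum_univ_two, Fin.sum_univ_four, ofCoords_fst, ofCoords_snd, of_apply, cons_val,
    dotProduct, Fin.sum_univ_eight]
  push_cast
  linear_combination (4 * (a 5 * b 5 + a 6 * b 6 : ℂ)) * p_zero_one_mul_p_one_zero +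
    2 * (a 5 * b 6 + a 6 * b 5 : ℂ) * (p_zero_one_sq + p_one_zero_sq)

/-- The coordinates, in the sense of `ofCoords`, of the entries of the representation of a block. -/
def BlockType.coords : (t : BlockType) → Matrix (Fin t.size) (Fin t.size) (Fin 8 → ℤ)
  | .u => !![![1, 1, 0, 0, 0, 0, 0, 0], ![1, -1, 0, 0, 0, 0, 0, 0],
        ![0, 0, 0, 0, 1, 1, 0, 0], ![0, 0, 0, 0, 1, -1, 0, 0];
      ![1, -1, 0, 0, 0, 0, 0, 0], ![1, 1, 0, 0, 0, 0, 0, 0],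
        ![0, 0, 0, 0, 1, -1, 0, 0], ![0, 0, 0, 0, 1, 1, 0, 0];
      ![0, 0, 0, 0, 1, 0, 1, 0], ![0, 0, 0, 0, 1, 0, -1, 0],
        ![1, 0, 1, 0, 0, 0, 0, 0], ![1, 0, -1, 0, 0, 0, 0, 0];
      ![0, 0, 0, 0, 1, 0, -1, 0], ![0, 0, 0, 0, 1, 0, 1, 0],
        ![1, 0, -1, 0, 0, 0, 0, 0], ![1, 0, 1, 0, 0, 0, 0, 0]]
  | .w => !![![1, 0, 0, 1, 0, 0, 0, 0], ![1, 0, 0, -1, 0, 0, 0, 0],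
        ![0, 0, 0, 0, 1, 0, 0, 1], ![0, 0, 0, 0, 1, 0, 0, -1];
      ![1, 0, 0, -1, 0, 0, 0, 0], ![1, 0, 0, 1, 0, 0, 0, 0],
        ![0, 0, 0, 0, 1, 0, 0, -1], ![0, 0, 0, 0, 1, 0, 0, 1];
      ![0, 0, 0, 0, 1, 0, 0, 1], ![0, 0, 0, 0, 1, 0, 0, -1],
        ![1, 0, 0, 1, 0, 0, 0, 0], ![1, 0, 0, -1, 0, 0, 0, 0];
      ![0, 0, 0, 0, 1, 0, 0, -1], ![0, 0, 0, 0, 1, 0, 0, 1],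
        ![1, 0, 0, -1, 0, 0, 0, 0], ![1, 0, 0, 1, 0, 0, 0, 0]]
  | .x => !![![2, 0, 0, 0, 0, 0, 0, 0], ![0, 0, 0, 0, 2, 0, 0, 0];
      ![0, 0, 0, 0, 2, 0, 0, 0], ![2, 0, 0, 0, 0, 0, 0, 0]]
  | .y => !![![1, 0, 0, 1, 1, 0, 0, 1], ![1, 0, 0, -1, 1, 0, 0, -1];
      ![1, 0, 0, -1, 1, 0, 0, -1], ![1, 0, 0, 1, 1, 0, 0, 1]]
  | .z => !![![1, 0, 0, 1, 1, 0, 0, -1], ![1, 0, 0, -1, 1, 0, 0, 1];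
      ![1, 0, 0, -1, 1, 0, 0, 1], ![1, 0, 0, 1, 1, 0, 0, -1]]
  | .one => !![![2, 0, 0, 0, 2, 0, 0, 0]]

theorem KP.ext_coords {a b : KP} (h : a.1 0 = b.1 0 ∧ a.1 1 = b.1 1 ∧ a.1 2 = b.1 2 ∧
    a.1 3 = b.1 3 ∧ a.2 0 0 = b.2 0 0 ∧ a.2 0 1 = b.2 0 1 ∧ a.2 1 0 = b.2 1 0 ∧
    a.2 1 1 = b.2 1 1) : a = b := by
  obtain ⟨h0, h1, h2, h3, h00, h01, h10, h11⟩ := h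
  ext i j
  · fin_cases i <;> assumption
  · fin_cases i <;> fin_cases j <;> assumption

theorem BlockType.rep_eq_ofCoords : ∀ (t : BlockType) (x y : Fin t.size),
    t.rep x y = ofCoords (t.coords x y)
  | .u => by
    have p_zero_zero : p 0 0 = 1 / 2 := rfl
    have p_one_one : p 1 1 = 1 / 2 := rfl
    change ∀ x y : Fin 4, repU x y = ofCoords _
    intro x y
    fin_cases x <;> fin_cases y <;> refine KP.ext_coords ?_ <;>
      simp [repU, ofCoords_fst, ofCoords_snd, BlockType.coords, ofMat, p_zero_zero, p_one_one] <;>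
      norm_num
  | .w => by
    change ∀ x y : Fin 4, repW x y = ofCoords _
    intro x y
    fin_cases x <;> fin_cases y <;> refine KP.ext_coords ?_ <;>
      simp [repW, ofCoords_fst, ofCoords_snd, BlockType.coords]
  | .x => by
    change ∀ x y : Fin 2, repX x y = ofCoords _
    intro x y
    fin_cases x <;> fin_cases y <;> refine KP.ext_coords ?_ <;>
      simp [repX, ofCoords_fst, ofCoords_snd, BlockType.coords, ofMat]
  | .y => by
    change ∀ x y : Fin 2, repY x y = ofCoords _
    intro x y
    fin_cases x <;> fin_cases y <;> refine KP.ext_coords ?_ <;>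
      simp [repY, ofCoords_fst, ofCoords_snd, BlockType.coords]
  | .z => by
    change ∀ x y : Fin 2, repZ x y = ofCoords _
    intro x y
    fin_cases x <;> fin_cases y <;> refine KP.ext_coords ?_ <;>
      simp [repZ, ofCoords_fst, ofCoords_snd, BlockType.coords]
  | .one => by
    change ∀ x y : Fin 1, (1 : Matrix (Fin 1) (Fin 1) KP) x y = ofCoords _
    intro x y
    fin_cases x; fin_cases y
    refine KP.ext_coords ?_
    simp [ofCoords_fst, ofCoords_snd, BlockType.coords]

end Coordinates

section Isometries

/-- The elements of `D₄` which act on the columns of all blocks through one and the same isometry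
of the coordinates. -/
def columnIsometries : Submonoid D4 where
  carrier := {ω | ∃ T : (Fin 8 → ℤ) → (Fin 8 → ℤ), (∀ a b, T a ⬝ᵥ T b = a ⬝ᵥ b) ∧
    ∀ (t : BlockType) (x y : Fin t.size), t.coords x (t.action ω y) = T (t.coords x y)}
  one_mem' := ⟨id, fun _ _ => rfl, fun t x y => by rw [map_one]; rfl⟩
  mul_mem' := by
    rintro ω η ⟨T, hT, hω⟩ ⟨T', hT', hη⟩
    refine ⟨T ∘ T', fun a b => (hT _ _).trans (hT' _ _), fun t x y => ?_⟩
    rw [map_mul, Equiv.Perm.mul_apply, hω, hη, Function.comp_apply]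

theorem flip_mem_columnIsometries : flip ∈ columnIsometries := by
  refine ⟨fun a => ![a 0, -a 1, a 2, a 3, a 4, a 5, -a 6, a 7], fun a b => ?_, ?_⟩
  · simp [dotProduct, Fin.sum_univ_eight]
  · rintro (_ | _ | _ | _ | _ | _) <;> decide

theorem cross_mem_columnIsometries : cross ∈ columnIsometries := by
  refine ⟨fun a => ![a 4, a 5, a 6, a 7, a 0, a 1, a 2, a 3], fun a b => ?_, ?_⟩
  · simp only [dotProduct, Fin.sum_univ_eight, cons_val]
    ring
  · rintro (_ | _ | _ | _ | _ | _) <;> decide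

theorem columnIsometries_eq_top : columnIsometries = ⊤ := by
  rw [eq_top_iff, ← closure_flip_cross, Submonoid.closure_le]
  rintro ω (rfl | rfl)
  exacts [flip_mem_columnIsometries, cross_mem_columnIsometries]

end Isometries

namespace BlockLabelling

variable {V : Type*} {u : Matrix V V KP} (L : BlockLabelling u)

theorem apply_eq_blockDiagonal (i j : V) :
    u i j = blockDiagonal' (fun q => (L.type q).rep) (L.label i) (L.label j) :=
  congrFun₂ L.eq_blockDiagonal i j

theorem label_action (ω : D4) (j : V) : L.label (L.action ω j) =
    ⟨(L.label j).1, (L.type (L.label j).1).action ω (L.label j).2⟩ :=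
  L.label.apply_symm_apply _

theorem apply_eq_zero_or_eq_rep (i j : V) :
    (∀ ω, u i (L.action ω j) = 0) ∨
      ∃ (t : BlockType) (x y : Fin t.size), ∀ ω, u i (L.action ω j) = t.rep x (t.action ω y) := by
  simp only [L.apply_eq_blockDiagonal, L.label_action]
  rcases L.label i with ⟨q, x⟩
  rcases L.label j with ⟨q', y⟩
  by_cases hq : q = q'
  · subst hq
    exact .inr ⟨L.type q, x, y, fun ω => blockDiagonal'_apply_eq ..⟩
  · exact .inl fun ω => blockDiagonal'_apply_ne _ _ _ hq

theorem haar_mul_action (ω : D4) (i j k l : V) :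
    haar (u i (L.action ω j) * u k (L.action ω l)) = haar (u i j * u k l) := by
  obtain ⟨T, hT, hω⟩ : ω ∈ columnIsometries := columnIsometries_eq_top ▸ Submonoid.mem_top ω
  have action_one (j : V) : L.action 1 j = j := by rw [map_one, Equiv.Perm.one_apply]
  rcases L.apply_eq_zero_or_eq_rep i j with hij | ⟨t, x, y, hij⟩
  · rw [hij, ← action_one j, hij, zero_mul, zero_mul]
  rcases L.apply_eq_zero_or_eq_rep k l with hkl | ⟨t', x', y', hkl⟩
  · rw [hkl, ← action_one l, hkl, mul_zero, mul_zero]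
  have hij_one := hij 1
  have hkl_one := hkl 1
  rw [action_one, map_one, Equiv.Perm.one_apply] at hij_one hkl_one
  refine mul_left_cancel₀ (show (8 : ℂ) ≠ 0 by norm_num) ?_
  simp only [hij, hkl, hij_one, hkl_one, BlockType.rep_eq_ofCoords, hω,
    eight_mul_haar_ofCoords_mul_ofCoords, hT]

theorem preservesOrbitals_action [Fintype V] (hu : IsMagic u) (ω : D4) :
    PreservesOrbitals u (L.action ω) := fun a b => by
  have mul_eq_zero_iff (i j k l : V) : u i j * u k l = 0 ↔ haar (u i j * u k l) = 0 :=
    isFaithfulPositive_haar.mul_eq_zero_iff isHaarTrace_haar.map_mul_comm (hu.proj i j)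
      (hu.proj k l)
  simp only [OrbitalRel, Prod.map_fst, Prod.map_snd, ne_eq, mul_eq_zero_iff, L.haar_mul_action]

theorem action_injective (h : ∃ q, L.type q = .u) : Function.Injective L.action := by
  obtain ⟨q, hq⟩ := h
  intro ω η hωη
  have action_eq (x : Fin (L.type q).size) :
      (L.type q).action ω x = (L.type q).action η x := by
    have := L.label_action ω (L.label.symm ⟨q, x⟩)
    rw [hωη, label_action, Equiv.apply_symm_apply] at this
    exact (sigma_mk_injective this).symm
  rw [hq] at action_eq
  exact Subtype.ext (Equiv.ext action_eq)

end BlockLabelling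

section Frucht

/-- The functions on `G₀` which agree at the points `0` and `3` of the classical version. The
entries of all blocks other than `u^{G₀}` are of this kind. -/
def agreeSubalgebra : StarSubalgebra ℂ KP where
  toSubalgebra := AlgHom.equalizer (character 0) (character 3)
  star_mem' ha := congrArg star ha

theorem mem_agreeSubalgebra {a : KP} : a ∈ agreeSubalgebra ↔ a.1 0 = a.1 3 := Iff.rfl

theorem agreeSubalgebra_ne_top : agreeSubalgebra ≠ ⊤ := fun h => by
  have mem : f 0 ∈ agreeSubalgebra := h ▸ StarSubalgebra.mem_top
  simp [mem_agreeSubalgebra] at mem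

theorem BlockType.rep_mem_agreeSubalgebra {t : BlockType} (ht : t ≠ .u) (x y : Fin t.size) :
    t.rep x y ∈ agreeSubalgebra := by
  have coords_eq_zero : t.coords x y 1 = 0 ∧ t.coords x y 2 = 0 := by
    revert x y
    cases t
    · exact absurd rfl ht
    all_goals decide
  rw [mem_agreeSubalgebra, BlockType.rep_eq_ofCoords, ofCoords_fst]
  simp [coords_eq_zero.1, coords_eq_zero.2]

theorem BlockLabelling.exists_type_eq_u {V : Type*} {u : Matrix V V KP} (L : BlockLabelling u)
    (h : StarAlgebra.adjoin ℂ (entries u) = ⊤) : ∃ q, L.type q = .u := by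
  by_contra! hL
  refine agreeSubalgebra_ne_top (top_le_iff.mp (h ▸ StarAlgebra.adjoin_le ?_))
  rintro _ ⟨⟨i, j⟩, rfl⟩
  change u i j ∈ agreeSubalgebra
  rw [L.apply_eq_blockDiagonal, blockDiagonal'_apply]
  split_ifs
  · exact BlockType.rep_mem_agreeSubalgebra (hL _) _ _
  · exact zero_mem _

theorem not_hasFruchtProperty : ¬ HasFruchtProperty KP := by
  rintro ⟨N, X, v, hv, hXv⟩
  obtain ⟨L⟩ := nonempty_blockLabelling hv.isMagicRep
  have adj_iff (ω : D4) := (L.preservesOrbitals_action hv.magic ω).adj_iff hv.isMagicRep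
    isFaithfulPositive_haar (hXv.preserves (fund_preserves X))
  have : Finite (X ≃g X) := DFunLike.finite _
  have card_d4_le : Nat.card D4 ≤ Nat.card (X ≃g X) :=
    Nat.card_le_card_of_injective (fun ω => ⟨L.action ω, adj_iff ω _ _⟩) fun ω η h =>
      L.action_injective (L.exists_type_eq_u hv.generates) (congrArg RelIso.toEquiv h)
  have : Finite (KP →ₐ[ℂ] ℂ) := Nat.finite_of_card_ne_zero (by rw [natCard_algHom]; norm_num)
  have card_le := card_d4_le.trans (hXv.card_aut_le_card_algHom hv.generates)
  rw [natCard_d4, natCard_algHom] at card_le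
  norm_num at card_le

end Frucht

end

end KacPaljutkin

open QuantumAut KacPaljutkin in
theorem mainTheorem1 :
    -- there is no finite graph `X` with `G⁺(X) = G₀`
    ¬ HasFruchtProperty KP ∧
    -- for every embedding `G₀ ⊂ S_N⁺`, an explicit copy of `D₄` preserves every orbital, and is
    -- contained in `G(X)` for every graph `X` on which `G₀` acts
    Nonempty (D4 ≃* DihedralGroup 4) ∧
    (∀ (N : ℕ) (u : Matrix (Fin N) (Fin N) KP), IsFundamentalMagicRep u →
      ∃ L : BlockLabelling u,
        (∃ q, L.type q = BlockType.u) ∧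
        Function.Injective L.action ∧
        (∀ (ω : D4) (o : Set (Fin N × Fin N)), IsOrbital u o →
          Prod.map (L.action ω) (L.action ω) '' o = o) ∧
        ∀ X : SimpleGraph (Fin N), Preserves u X →
          ∀ (ω : D4) (i j : Fin N), X.Adj (L.action ω i) (L.action ω j) ↔ X.Adj i j) ∧
    -- the classical version of `G₀` is `ℤ₂ × ℤ₂`
    Nonempty (ClassicalVersion KP ≃* Multiplicative (ZMod 2 × ZMod 2)) := by
  refine ⟨not_hasFruchtProperty, nonempty_d4_mulEquiv_dihedralGroup, fun N u hu => ?_,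
    nonempty_classicalVersion_mulEquiv⟩
  obtain ⟨L⟩ := nonempty_blockLabelling hu.isMagicRep
  have exists_u := L.exists_type_eq_u hu.generates
  have preserves := L.preservesOrbitals_action hu.magic
  exact ⟨L, exists_u, L.action_injective exists_u, fun ω _ ho => (preserves ω).image_eq ho,
    fun X hX ω => (preserves ω).adj_iff hu.isMagicRep isFaithfulPositive_haar hX⟩
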